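/- Let $d\in\mathbb N$, $X=D=[-1,1]^d$, $Y=\{-1,1\}$, and let $\rho$ be a Borel probability measure on $X\times Y$ with marginal $\rho_X$ and conditional distributions $\rho(\cdot|x)$. For a classifier $C:X\to Y$ let $\mathcal R(C)=\rho\{(x,y):C(x)\ne y\}$; let $f_c$ be the Bayes rule ($f_c(x)=1$ if $\rho(y=1|x)\ge\rho(y=-1|x)$, and $-1$ otherwise) and $f_\rho(x)=2\rho(y=1|x)-1$. Put $\mathrm{sgn}(t)=1$ for $t\ge 0$ and $-1$ for $t<0$. Let $\phi(v)=(1-v)_+^2$, $\mathcal E(f)=\int\phi(yf(x))\,d\rho$, and let $f_\rho^\phi$ be a minimizer of $\mathcal E$ over all measurable functions. For $m\ge1$, a constant $C_5>0$ and $\sigma(t)=\max\{t,0\}$ let $$\mathcal H_m=\Big\{\sum_{k=1}^m\beta_k\sigma(\alpha_k\cdot x-b_k):\ \|\alpha_k\|_1\le1,\ 0\le b_k\le1,\ |\beta_k|\le\frac{4\pi^2C_5\,m^{\frac1{10}(1+\frac2d)}}{m}\Big\}.$$ For a sample $z=\{(x_i,y_i)\}_{i=1}^N$ drawn independently from $\rho$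 let $f_z$ denote a minimizer over $\mathcal H_m$ of $\frac1N\sum_{i=1}^N\phi(y_if(x_i))$. Put $B=\sup_{f\in\mathcal H_m}\|f\|_\infty$ and $C_0'=\|\phi\|_{L_\infty[-\max\{B,1\},\max\{B,1\}]}$. Let $1\le p\le\infty$, and put $\kappa=0$ if $p\ge2$ and $\kappa=(2/p-1)d^2$ if $p<2$. Assume: (a) (variance condition) for some $C_1>0$ and $\tau\in(0,1]$, $\mathbb E\{(\phi(yf(x))-\phi(yf_\rho^\phi(x)))^2\}\le C_1\{\mathcal E(f)-\mathcal E(f_\rho^\phi)\}^\tau$ for every measurable $f:X\to[-1,1]$ (for the squared hinge loss the exponent is $\tau=1$); (b) (Tsybakov noise condition with exponent $\theta>0$ and constant $c_\theta>0$) $\rho_X(\{x:0<|f_\rho(x)|\le c_\theta t\})\le t^\theta$ for all $t>0$; (c) (approximation error) $\inf_{f\in\mathcal H_m}\{\mathcal E(f)-\mathcal E(f_\rho^\phi)\}\le C^\phi m^{-\frac{4d+8}{5d+\kappa}}$; (d) $N=m^{\frac{9d+8+\kappa}{5d+\kappa}}$, rounded up or down to an integer. Then for every $\delta>0$, with confidence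 $1-\delta$ (on a measurable set of samples of probability at least $1-\delta$), for every such minimizer $f_z$, $$\mathcal R(\mathrm{sgn}(f_z))-\mathcal R(f_c)\le K\,\max\{1,C^\phi\}^{\left(\frac{\theta}{2+\theta}-\frac12\right)_+}\,C_8\,N^{-\frac{\theta}{2+\theta}\cdot\frac{4d+8}{9d+8+\kappa}},$$ $$C_8=\sqrt{\big[8C^\phi+24\max\{4,C_1\}+3C_0'+16C_1\big]\,\max\Big\{\log N,\log\frac{2N}{\delta}\Big\}\,\log\frac2\delta},$$ where $K>0$ depends only on $d,C_5,\theta,c_\theta$, and not on $p,\rho,C_1,\tau,C^\phi,m,N,\delta$. For $\theta\le2$ the factor $\max\{1,C^\phi\}^{(\cdot)_+}$ is $1$. -/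

import Mathlib

open MeasureTheory

namespace ShallowClassification

noncomputable section

/-- The input space `X = D = [-1,1]^d`. -/
abbrev Cube (d : ℕ) : Type := ↥(Set.Icc (-1 : Fin d → ℝ) 1)

/-- The output space `Y = {-1, 1}`. -/
abbrev Label : Type := ↥({-1, 1} : Set ℝ)

/-- The label `1`. -/
def posLabel : Label := ⟨1, by simp⟩

/-- The label `-1`. -/
def negLabel : Label := ⟨-1, by simp⟩

/-- The squared hinge loss `φ(v) = (1 - v)_+ ^ 2`. -/
def sqHinge (v : ℝ) : ℝ := (max (1 - v) 0) ^ 2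

/-- The ReLU activation `σ(t) = max {t, 0}`. -/
def relu (t : ℝ) : ℝ := max t 0

/-- The hypothesis space `H_m` of shallow ReLU networks `x ↦ ∑ k, β k * σ (α k · x - b k)` of
width `m` on `[-1,1]^d` with `‖α k‖₁ ≤ 1`, `0 ≤ b k ≤ 1` and
`|β k| ≤ 4 π² C₅ m ^ ((1 + 2 / d) / 10) / m`. -/
def hypothesisSpace (d m : ℕ) (C₅ : ℝ) : Set (Cube d → ℝ) :=
  {f | ∃ (α : Fin m → Fin d → ℝ) (β b : Fin m → ℝ),
    (∀ k, ∑ j, |α k j| ≤ 1) ∧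
    (∀ k, 0 ≤ b k ∧ b k ≤ 1) ∧
    (∀ k, |β k| ≤ 4 * Real.pi ^ 2 * C₅ * (m : ℝ) ^ ((1 / 10 : ℝ) * (1 + 2 / (d : ℝ))) / (m : ℝ)) ∧
    ∀ x : Cube d, f x = ∑ k, β k * relu ((∑ j, α k j * (x : Fin d → ℝ) j) - b k)}

section General

variable {X : Type*} [MeasurableSpace X]

/-- The misclassification error `R(C) = Prob {C(x) ≠ y}` of a classifier `C : X → Y`. -/
def misclassError (ρ : Measure (X × Label)) (C : X → Label) : ℝ :=
  ρ.real {z | C z.1 ≠ z.2}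

/-- The classifier `sgn(f)`, with `sgn(0) = 1`. -/
def sgnClassifier (f : X → ℝ) (x : X) : Label := if 0 ≤ f x then posLabel else negLabel

/-- The conditional probability `ρ(y | x)`. -/
def condProb (ρ : Measure (X × Label)) [IsFiniteMeasure ρ] (x : X) (y : Label) : ℝ :=
  (ρ.condKernel x).real {y}

/-- The Bayes rule `f_c`: `1` if `ρ(1 | x) ≥ ρ(-1 | x)` and `-1` otherwise. -/
def bayesRule (ρ : Measure (X × Label)) [IsFiniteMeasure ρ] (x : X) : Label :=
  if condProb ρ x negLabel ≤ condProb ρ x posLabel then posLabel else negLabel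

/-- The regression function `f_ρ(x) = 2 ρ(y = 1 | x) - 1`. -/
def regressionFun (ρ : Measure (X × Label)) [IsFiniteMeasure ρ] (x : X) : ℝ :=
  2 * condProb ρ x posLabel - 1

/-- The Tsybakov noise condition with exponent `θ` and constant `c`, where `ρ_X = ρ.fst` is the
marginal distribution. -/
def TsybakovNoise (ρ : Measure (X × Label)) [IsFiniteMeasure ρ] (θ c : ℝ) : Prop :=
  ∀ t : ℝ, 0 < t →
    ρ.fst.real {x | 0 < |regressionFun ρ x| ∧ |regressionFun ρ x| ≤ c * t} ≤ t ^ θ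

/-- The generalization error `∫ φ(y f(x)) dρ`, possibly infinite. -/
def genErrorENN (φ : ℝ → ℝ) (ρ : Measure (X × Label)) (f : X → ℝ) : ENNReal :=
  ∫⁻ z, ENNReal.ofReal (φ ((z.2 : ℝ) * f z.1)) ∂ρ

/-- The generalization error as a real number. -/
def genError (φ : ℝ → ℝ) (ρ : Measure (X × Label)) (f : X → ℝ) : ℝ :=
  (genErrorENN φ ρ f).toReal

/-- `g` is a minimizer of the generalization error over all measurable functions. -/
def IsGenErrorMinimizer (φ : ℝ → ℝ) (ρ : Measure (X × Label)) (g : X → ℝ) : Prop :=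
  Measurable g ∧ ∀ f : X → ℝ, Measurable f → genErrorENN φ ρ g ≤ genErrorENN φ ρ f

/-- The variance condition with constant `C₁` and exponent `τ`, over all measurable
`f : X → [-1,1]`; here `g` is the minimizer of the generalization error. -/
def VarianceCondition (φ : ℝ → ℝ) (ρ : Measure (X × Label)) (g : X → ℝ) (C₁ τ : ℝ) : Prop :=
  ∀ f : X → ℝ, Measurable f → (∀ x, f x ∈ Set.Icc (-1 : ℝ) 1) →
    ∫ z, (φ ((z.2 : ℝ) * f z.1) - φ ((z.2 : ℝ) * g z.1)) ^ 2 ∂ρ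
      ≤ C₁ * (genError φ ρ f - genError φ ρ g) ^ τ

/-- The approximation error `inf_{f ∈ H} {E(f) - E(g)}` of a hypothesis space `H`. -/
def approxError (φ : ℝ → ℝ) (ρ : Measure (X × Label)) (H : Set (X → ℝ)) (g : X → ℝ) : ℝ :=
  sInf ((fun f => genError φ ρ f - genError φ ρ g) '' H)

/-- The empirical error `(1/N) ∑ i, φ(y_i f(x_i))` on a sample `z`. -/
def empError (φ : ℝ → ℝ) {N : ℕ} (z : Fin N → X × Label) (f : X → ℝ) : ℝ :=
  (1 / (N : ℝ)) * ∑ i, φ (((z i).2 : ℝ) * f (z i).1)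

/-- `f` minimizes the empirical error over `H`. -/
def IsEmpMinimizer (φ : ℝ → ℝ) {N : ℕ} (z : Fin N → X × Label) (H : Set (X → ℝ))
    (f : X → ℝ) : Prop :=
  f ∈ H ∧ ∀ g ∈ H, empError φ z f ≤ empError φ z g

/-- `B = sup_{f ∈ H} ‖f‖_∞`. -/
def supBound (H : Set (X → ℝ)) : ℝ := sSup {r | ∃ f ∈ H, ∃ x, r = |f x|}

/-- `C₀' = ‖φ‖_{L_∞[-max{B,1}, max{B,1}]}` for a continuous `φ`, with `B = sup_{f ∈ H} ‖f‖_∞`. -/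
def lossBound (φ : ℝ → ℝ) (H : Set (X → ℝ)) : ℝ :=
  sSup ((fun v => |φ v|) '' Set.Icc (-(max (supBound H) 1)) (max (supBound H) 1))

end General

/-- The term that `p` contributes to the exponents: `0` for `2 ≤ p ≤ ∞` and `(2/p - 1) d²` for
`1 ≤ p < 2`. -/
def pTerm (d : ℕ) (p : ENNReal) : ℝ :=
  if 2 ≤ p then 0 else (2 / p.toReal - 1) * (d : ℝ) ^ 2

/-- The constant
`C₈ = √([8 C^φ + 24 max{4, C₁} + 3 C₀' + 16 C₁] max{log N, log (2N/δ)} log (2/δ))`. -/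
def constC₈ (Cφ C₁ C₀ : ℝ) (N : ℕ) (δ : ℝ) : ℝ :=
  Real.sqrt ((8 * Cφ + 24 * max 4 C₁ + 3 * C₀ + 16 * C₁)
    * max (Real.log N) (Real.log (2 * N / δ)) * Real.log (2 / δ))

end

end ShallowClassification

open ShallowClassification

namespace ShallowClassification

/-! ### Exponential deviation bounds for i.i.d. sums. -/

section Concentration

variable {Ω : Type*} [MeasurableSpace Ω]

/-! On `[-1,1]` the squared hinge loss is the least squares loss: `φ(yu) = (y-u)²`. Clipping a
function to `[-1,1]` never increases its loss and keeps its sign. Hence for clipped `f` the excess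
loss over `f_ρ` has mean `‖clip f - f_ρ‖²` in `L²(ρ_X)` (`integral_projExcess`) and second moment at
most 16 times that (`integral_sq_projExcess_le`). A second moment controlled by the mean gives
deviations of order `1/N` instead of `1/√N`.

`oracle_inequality` combines this with a union bound over a finite net: the distance for an
empirical minimizer is at most a multiple of the approximation error plus `log(net size)/N`.
Discretizing the `m(d+2)` weights on a grid (`exists_netFun_close`) makes this last term of order `m
log N / N`, and the prescribed `N` makes `m/N` comparable with the approximation rate
(`sampleSize_estimates`). The result is `excess_rate`: a bound `E` of order `(C^φ + log N +
log(2/δ)) N^(-r)`, with `r = (4d+8)/(9d+8+κ)`.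

Tsybakov's condition turns `E` into a misclassification bound of order `E^((1+θ)/(2+θ))`
(`misclassError_sub_le`). The claim only asks for the power `θ/(2+θ)` of `N^(-r)`; the spare factor
`N^(-r/(2+θ))` absorbs the powers of `log N` that the square root in `C₈` does not cover
(`rate_of_excess_bound`). -/

lemma integrable_of_measurable_of_abs_le (μ : Measure Ω) [IsFiniteMeasure μ] {g : Ω → ℝ} {c : ℝ}
    (hg : Measurable g) (hc : ∀ x, |g x| ≤ c) : Integrable g μ :=
  Integrable.of_bound hg.aestronglyMeasurable c (Filter.Eventually.of_forall hc)

/-- Chernoff's bound for a sum over an i.i.d. sample. -/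
lemma chernoff_pi (μ : Measure Ω) [IsProbabilityMeasure μ] {g : Ω → ℝ} {a : ℝ}
    (hint : Integrable (fun x => Real.exp (g x)) μ)
    (ha : ∫ x, Real.exp (g x) ∂μ ≤ Real.exp a) (N : ℕ) (s : ℝ) :
    (Measure.pi (fun _ : Fin N => μ)).real {z | N * a + s ≤ ∑ i, g (z i)} ≤ Real.exp (-s) := by
  have hprod : ∫ z : Fin N → Ω, ∏ i, Real.exp (g (z i)) ∂(Measure.pi fun _ => μ)
      = (∫ x, Real.exp (g x) ∂μ) ^ N := by
    rw [integral_fintype_prod_eq_pow (ι := Fin N) (𝕜 := ℝ) (fun x => Real.exp (g x))]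
    simp
  have hI : Integrable (fun z : Fin N → Ω => ∏ i, Real.exp (g (z i)))
      (Measure.pi fun _ => μ) :=
    Integrable.fintype_prod (f := fun (_ : Fin N) x => Real.exp (g x)) (fun _ => hint)
  have hM := mul_meas_ge_le_integral_of_nonneg
    (Filter.Eventually.of_forall fun z => Finset.prod_nonneg fun i _ => (Real.exp_pos (g (z i))).le)
    hI (Real.exp (N * a + s))
  have hset : {z : Fin N → Ω | Real.exp (N * a + s) ≤ ∏ i, Real.exp (g (z i))}
      = {z | N * a + s ≤ ∑ i, g (z i)} := by
    ext z
    simp only [Set.mem_ofPred_eq]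
    rw [← Real.exp_sum, Real.exp_le_exp]
  rw [hset, hprod] at hM
  have h2 : (∫ x, Real.exp (g x) ∂μ) ^ N ≤ Real.exp (N * a) := by
    rw [Real.exp_nat_mul]
    exact pow_le_pow_left₀ (integral_nonneg fun x => (Real.exp_pos _).le) ha N
  have h3 := hM.trans h2
  rw [Real.exp_add, mul_assoc] at h3
  have h4 := le_of_mul_le_mul_left (h3.trans_eq (mul_one _).symm) (Real.exp_pos _)
  rw [Real.exp_neg, ← one_div, le_div_iff₀ (Real.exp_pos s)]
  linarith

lemma exp_le_one_add_add_sq {x : ℝ} (hx : |x| ≤ 1) : Real.exp x ≤ 1 + x + x ^ 2 := by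
  have := (abs_le.1 (Real.abs_exp_sub_one_sub_id_le hx)).2
  linarith

/-- Since `exp x ≤ 1 + x + x²` for `|x| ≤ 1`, the variance hypothesis lets the quadratic term be
charged to the mean, so the exponent is a multiple of the mean alone. -/
lemma integral_exp_mul_le (μ : Measure Ω) [IsProbabilityMeasure μ] {g : Ω → ℝ} {c l : ℝ}
    (hg : Measurable g) (hl : |l| * c ≤ 1) (hgc : ∀ x, |g x| ≤ c)
    (hvar : ∫ x, g x ^ 2 ∂μ ≤ c * ∫ x, g x ∂μ) :
    Integrable (fun x => Real.exp (l * g x)) μ ∧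
      ∫ x, Real.exp (l * g x) ∂μ ≤ Real.exp ((l + l ^ 2 * c) * ∫ x, g x ∂μ) := by
  have hb : ∀ x, |l * g x| ≤ 1 := fun x => by
    rw [abs_mul]
    exact (mul_le_mul_of_nonneg_left (hgc x) (abs_nonneg l)).trans hl
  have hgi : Integrable g μ := integrable_of_measurable_of_abs_le μ hg hgc
  have hg2 : Integrable (fun x => g x ^ 2) μ :=
    integrable_of_measurable_of_abs_le μ (c := c ^ 2) (hg.pow_const 2) (fun x => by
      rw [abs_pow]; exact pow_le_pow_left₀ (abs_nonneg _) (hgc x) 2)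
  have hei : Integrable (fun x => Real.exp (l * g x)) μ :=
    integrable_of_measurable_of_abs_le μ (c := Real.exp 1) (hg.const_mul l).exp (fun x => by
      rw [abs_of_pos (Real.exp_pos _), Real.exp_le_exp]; exact (abs_le.1 (hb x)).2)
  refine ⟨hei, ?_⟩
  have hli : Integrable (fun x => 1 + l * g x) μ := (integrable_const _).add (hgi.const_mul l)
  calc ∫ x, Real.exp (l * g x) ∂μ ≤ ∫ x, ((1 + l * g x) + l ^ 2 * g x ^ 2) ∂μ := by
        refine integral_mono hei (hli.add (hg2.const_mul _)) fun x => ?_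
        have := exp_le_one_add_add_sq (hb x)
        simp only
        linarith [mul_pow l (g x) 2]
    _ = 1 + l * ∫ x, g x ∂μ + l ^ 2 * ∫ x, g x ^ 2 ∂μ := by
        rw [integral_add hli (hg2.const_mul _),
          integral_add (integrable_const _) (hgi.const_mul l), integral_const_mul,
          integral_const_mul]
        simp
    _ ≤ 1 + (l + l ^ 2 * c) * ∫ x, g x ∂μ := by
        nlinarith [mul_le_mul_of_nonneg_left hvar (sq_nonneg l)]
    _ ≤ _ := by
        rw [add_comm]; exact Real.add_one_le_exp _

/-- Upper deviations of a sum when the second moment is controlled by the mean. -/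
lemma upper_deviation (μ : Measure Ω) [IsProbabilityMeasure μ] {g : Ω → ℝ} {c : ℝ}
    (hg : Measurable g) (hc : 0 < c) (hgc : ∀ x, |g x| ≤ c)
    (hvar : ∫ x, g x ^ 2 ∂μ ≤ c * ∫ x, g x ∂μ) (N : ℕ) (s : ℝ) :
    (Measure.pi (fun _ : Fin N => μ)).real
      {z | 2 * N * (∫ x, g x ∂μ) + c * s ≤ ∑ i, g (z i)} ≤ Real.exp (-s) := by
  obtain ⟨h1, h2⟩ := integral_exp_mul_le μ (l := 1 / c) hg
    (by rw [abs_of_pos (by positivity)]; field_simp; exact le_rfl) hgc hvar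
  refine le_trans (measureReal_mono (fun z hz => ?_) (measure_ne_top _ _)) (chernoff_pi μ h1 h2 N s)
  simp only [Set.mem_ofPred_eq] at hz ⊢
  rw [← Finset.mul_sum]
  have : N * ((1 / c + (1 / c) ^ 2 * c) * ∫ x, g x ∂μ) + s
      = (1 / c) * (2 * N * (∫ x, g x ∂μ) + c * s) := by
    field_simp; ring
  rw [this]
  exact mul_le_mul_of_nonneg_left hz (by positivity)

/-- Lower deviations of a sum when the second moment is controlled by the mean. -/
lemma lower_deviation (μ : Measure Ω) [IsProbabilityMeasure μ] {g : Ω → ℝ} {c : ℝ}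
    (hg : Measurable g) (hc : 0 < c) (hgc : ∀ x, |g x| ≤ c)
    (hvar : ∫ x, g x ^ 2 ∂μ ≤ c * ∫ x, g x ∂μ) (N : ℕ) (s : ℝ) :
    (Measure.pi (fun _ : Fin N => μ)).real
      {z | 2 * (∑ i, g (z i)) + 4 * c * s ≤ N * ∫ x, g x ∂μ} ≤ Real.exp (-s) := by
  -- At slope `-1/c` the linear and quadratic terms would cancel; half of it leaves the coefficient
  -- `-1/(4c)`.
  obtain ⟨h1, h2⟩ := integral_exp_mul_le μ (l := -(1 / (2 * c))) hg
    (by rw [abs_neg, abs_of_pos (by positivity)]; field_simp; norm_num) hgc hvar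
  refine le_trans (measureReal_mono (fun z hz => ?_) (measure_ne_top _ _)) (chernoff_pi μ h1 h2 N s)
  simp only [Set.mem_ofPred_eq] at hz ⊢
  rw [← Finset.mul_sum]
  have : N * ((-(1 / (2 * c)) + (-(1 / (2 * c))) ^ 2 * c) * ∫ x, g x ∂μ) + s
      = (1 / (4 * c)) * (4 * c * s - N * (∫ x, g x ∂μ)) := by
    field_simp; ring
  rw [this]
  have h3 : -(1 / (2 * c)) * ∑ i, g (z i) = (1 / (4 * c)) * (-(2 * ∑ i, g (z i))) := by
    field_simp; ring
  rw [h3]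
  exact mul_le_mul_of_nonneg_left (by linarith) (by positivity)

end Concentration

/-! ### The squared hinge loss and clipping. -/

section Loss

/-- The projection of the real line onto `[-1, 1]`. -/
noncomputable def clip (t : ℝ) : ℝ := max (-1) (min t 1)

lemma clip_mem (t : ℝ) : -1 ≤ clip t ∧ clip t ≤ 1 := by
  unfold clip
  exact ⟨le_max_left _ _, max_le (by norm_num) (min_le_right _ _)⟩

lemma measurable_clip : Measurable clip :=
  measurable_const.max (measurable_id.min measurable_const)

lemma abs_clip_sub_clip_le (s t : ℝ) : |clip s - clip t| ≤ |s - t| := by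
  unfold clip
  have h1 := abs_max_sub_max_le_max (-1) (min s 1) (-1) (min t 1)
  have h2 := abs_min_sub_min_le_max s 1 t 1
  rw [sub_self, abs_zero, max_eq_right (abs_nonneg (min s 1 - min t 1))] at h1
  rw [sub_self, abs_zero, max_eq_left (abs_nonneg _)] at h2
  exact h1.trans h2

lemma label_eq (y : Label) : (y : ℝ) = 1 ∨ (y : ℝ) = -1 := by
  rcases y with ⟨y, hy⟩
  rcases hy with h | h
  · exact Or.inr h
  · exact Or.inl h

lemma eq_posLabel_or_eq_negLabel (y : Label) : y = posLabel ∨ y = negLabel :=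
  (label_eq y).imp (fun h => Subtype.ext h) (fun h => Subtype.ext h)

lemma posLabel_ne_negLabel : posLabel ≠ negLabel := by
  intro h
  have := congrArg Subtype.val h
  norm_num [posLabel, negLabel] at this

lemma sqHinge_nonneg (v : ℝ) : 0 ≤ sqHinge v := sq_nonneg _

lemma measurable_sqHinge : Measurable sqHinge :=
  ((measurable_const.sub measurable_id).max measurable_const).pow_const 2

lemma sqHinge_le (v B : ℝ) (h : |v| ≤ B) : sqHinge v ≤ (1 + B) ^ 2 := by
  unfold sqHinge
  have := abs_le.1 h
  have h0 := abs_nonneg v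
  exact pow_le_pow_left₀ (le_max_right _ _) (max_le (by linarith) (by linarith)) 2

/-- The positive part is inactive here, and `y² = 1` turns `(1 - yu)²` into `(y - u)²`. -/
lemma sqHinge_label_mul {u : ℝ} (hu : -1 ≤ u ∧ u ≤ 1) (y : Label) :
    sqHinge (y * u) = (y - u) ^ 2 := by
  unfold sqHinge
  rcases label_eq y with h | h <;> rw [h, max_eq_left (by linarith [hu.1, hu.2])] <;> ring

/-- Where clipping acts, either the margin exceeds 1 and both losses vanish, or it lies below -1 and
is raised to -1. -/
lemma sqHinge_label_mul_clip_le (t : ℝ) (y : Label) :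
    sqHinge (y * clip t) ≤ sqHinge (y * t) := by
  unfold sqHinge
  refine pow_le_pow_left₀ (le_max_right _ _) ?_ 2
  unfold clip
  rcases label_eq y with h | h <;> rw [h]
  · rcases le_total t 1 with h1 | h1
    · rw [min_eq_left h1]
      exact max_le_max_right _ (by linarith [le_max_right (-1) t])
    · rw [min_eq_right h1]; norm_num
  · rcases le_total t (-1) with h1 | h1
    · rw [min_eq_left (by linarith), max_eq_left h1]
      norm_num
    · rw [max_eq_right (le_min h1 (by norm_num))]
      exact max_le_max_right _ (by linarith [min_le_left t 1])

lemma abs_label_mul (y : Label) (t : ℝ) : |(y : ℝ) * t| = |t| := by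
  rcases label_eq y with h | h <;> rw [h] <;> simp

lemma sqHinge_label_mul_le {X : Type*} {f : X → ℝ} {B : ℝ} (hB : ∀ x, |f x| ≤ B) (z : X × Label) :
    |sqHinge (z.2 * f z.1)| ≤ (1 + B) ^ 2 := by
  rw [abs_of_nonneg (sqHinge_nonneg _)]
  exact sqHinge_le _ _ (by rw [abs_label_mul]; exact hB _)

end Loss

/-! ### Conditional expectations and the excess loss over the regression function. -/

section Risk

variable {X : Type*} [MeasurableSpace X]

lemma measurable_regressionFun (ρ : Measure (X × Label)) [IsFiniteMeasure ρ] :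
    Measurable (regressionFun ρ) := by
  unfold regressionFun condProb Measure.real
  exact (((ProbabilityTheory.Kernel.measurable_coe ρ.condKernel
    (measurableSet_singleton posLabel)).ennreal_toReal).const_mul 2).sub_const 1

lemma condProb_negLabel (ρ : Measure (X × Label)) [IsFiniteMeasure ρ] (x : X) :
    condProb ρ x negLabel = 1 - condProb ρ x posLabel := by
  unfold condProb
  have h : ({negLabel} : Set Label) = {posLabel}ᶜ := by
    ext y
    simp only [Set.mem_singleton_iff, Set.mem_compl_iff]
    rcases eq_posLabel_or_eq_negLabel y with h | h <;> subst h <;>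
      simp [posLabel_ne_negLabel, posLabel_ne_negLabel.symm]
  rw [h, probReal_compl_eq_one_sub (measurableSet_singleton _)]

lemma regressionFun_mem (ρ : Measure (X × Label)) [IsFiniteMeasure ρ] (x : X) :
    -1 ≤ regressionFun ρ x ∧ regressionFun ρ x ≤ 1 := by
  unfold regressionFun condProb
  have h1 : 0 ≤ (ρ.condKernel x).real {posLabel} := measureReal_nonneg
  have h2 : (ρ.condKernel x).real {posLabel} ≤ 1 := measureReal_le_one
  constructor <;> linarith

lemma bayesRule_eq_sgnClassifier (ρ : Measure (X × Label)) [IsFiniteMeasure ρ] :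
    bayesRule ρ = sgnClassifier (regressionFun ρ) := by
  funext x
  unfold bayesRule sgnClassifier
  rw [condProb_negLabel]
  unfold regressionFun
  refine if_congr ⟨fun h => by linarith, fun h => by linarith⟩ rfl rfl

/-- Integration over `X × Y` as conditional expectation given `x`, in terms of `f_ρ`. -/
lemma integral_eq_integral_regressionFun (ρ : Measure (X × Label)) [IsFiniteMeasure ρ]
    {F : X × Label → ℝ} {c : ℝ} (hF : Measurable F) (hc : ∀ z, |F z| ≤ c) :
    ∫ z, F z ∂ρ = ∫ x, ((1 + regressionFun ρ x) / 2 * F (x, posLabel)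
      + (1 - regressionFun ρ x) / 2 * F (x, negLabel)) ∂ρ.fst := by
  rw [← Measure.integral_condKernel (integrable_of_measurable_of_abs_le ρ hF hc)]
  congr 1
  funext x
  have h : ∀ y, F (x, y) = F (x, negLabel)
      + Set.indicator {posLabel} (fun _ => F (x, posLabel) - F (x, negLabel)) y := by
    intro y
    rcases eq_posLabel_or_eq_negLabel y with h | h <;> subst h
    · simp
    · rw [Set.indicator_of_notMem (by simpa using posLabel_ne_negLabel.symm)]; simp
  rw [integral_congr_ae (Filter.Eventually.of_forall h), integral_add (integrable_const _)
    ((integrable_const _).indicator (measurableSet_singleton _)),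
    integral_indicator (measurableSet_singleton _)]
  simp only [integral_const, measureReal_restrict_apply_univ, probReal_univ, smul_eq_mul]
  unfold regressionFun condProb
  ring

/-- The squared `L²(ρ_X)` distance from the projected function to the regression function. -/
noncomputable def projDist (ρ : Measure (X × Label)) [IsFiniteMeasure ρ] (f : X → ℝ) : ℝ :=
  ∫ x, (clip (f x) - regressionFun ρ x) ^ 2 ∂ρ.fst

/-- The loss of the projected function in excess of the loss of the regression function. -/
noncomputable def projExcess (ρ : Measure (X × Label)) [IsFiniteMeasure ρ] (f : X → ℝ)
    (z : X × Label) : ℝ :=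
  sqHinge (z.2 * clip (f z.1)) - sqHinge (z.2 * regressionFun ρ z.1)

lemma measurable_label_mul {g : X → ℝ} (hg : Measurable g) :
    Measurable fun z : X × Label => sqHinge (z.2 * g z.1) :=
  measurable_sqHinge.comp ((measurable_subtype_coe.comp measurable_snd).mul
    (hg.comp measurable_fst))

lemma measurable_projExcess (ρ : Measure (X × Label)) [IsFiniteMeasure ρ] {f : X → ℝ}
    (hf : Measurable f) : Measurable (projExcess ρ f) :=
  (measurable_label_mul (measurable_clip.comp hf)).sub
    (measurable_label_mul (measurable_regressionFun ρ))

lemma projExcess_eq (ρ : Measure (X × Label)) [IsFiniteMeasure ρ] (f : X → ℝ) (z : X × Label) :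
    projExcess ρ f z = (z.2 - clip (f z.1)) ^ 2 - (z.2 - regressionFun ρ z.1) ^ 2 := by
  unfold projExcess
  rw [sqHinge_label_mul (clip_mem _), sqHinge_label_mul (regressionFun_mem ρ _)]

lemma abs_projExcess_le (ρ : Measure (X × Label)) [IsFiniteMeasure ρ] (f : X → ℝ)
    (z : X × Label) : |projExcess ρ f z| ≤ 4 := by
  rw [projExcess_eq]
  have h1 := clip_mem (f z.1)
  have h2 := regressionFun_mem ρ z.1
  rcases label_eq z.2 with h | h <;> rw [h, abs_le] <;> constructor <;> nlinarith

/-- A difference of squares, whose other factor `2y - clip f - f_ρ` lies in `[-4,4]`. -/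
lemma sq_projExcess_le (ρ : Measure (X × Label)) [IsFiniteMeasure ρ] (f : X → ℝ)
    (z : X × Label) :
    projExcess ρ f z ^ 2 ≤ 16 * (clip (f z.1) - regressionFun ρ z.1) ^ 2 := by
  rw [projExcess_eq]
  have h1 := clip_mem (f z.1)
  have h2 := regressionFun_mem ρ z.1
  have h3 : ((z.2 : ℝ) - clip (f z.1)) ^ 2 - (z.2 - regressionFun ρ z.1) ^ 2
    = (2 * z.2 - clip (f z.1) - regressionFun ρ z.1) * (-(clip (f z.1) - regressionFun ρ z.1)) := by
    ring
  rw [h3, mul_pow, neg_sq]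
  refine mul_le_mul_of_nonneg_right ?_ (sq_nonneg _)
  rw [show (16 : ℝ) = 4 ^ 2 by norm_num]
  refine sq_le_sq' ?_ ?_ <;> rcases label_eq z.2 with h | h <;> rw [h] <;> linarith

lemma measurable_sq_clip_sub (ρ : Measure (X × Label)) [IsFiniteMeasure ρ] {f : X → ℝ}
    (hf : Measurable f) : Measurable fun x => (clip (f x) - regressionFun ρ x) ^ 2 :=
  ((measurable_clip.comp hf).sub (measurable_regressionFun ρ)).pow_const 2

lemma abs_sq_clip_sub_le (ρ : Measure (X × Label)) [IsFiniteMeasure ρ] (f : X → ℝ) (x : X) :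
    |(clip (f x) - regressionFun ρ x) ^ 2| ≤ 4 := by
  have h1 := clip_mem (f x)
  have h2 := regressionFun_mem ρ x
  rw [abs_of_nonneg (sq_nonneg _)]
  nlinarith

/-- Bias-variance decomposition: `f_ρ(x)` is the conditional mean of `y`, so the cross term
vanishes. -/
lemma integral_projExcess (ρ : Measure (X × Label)) [IsFiniteMeasure ρ] {f : X → ℝ}
    (hf : Measurable f) : ∫ z, projExcess ρ f z ∂ρ = projDist ρ f := by
  rw [integral_eq_integral_regressionFun ρ (measurable_projExcess ρ hf) (abs_projExcess_le ρ f)]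
  unfold projDist
  congr 1
  funext x
  simp only [projExcess_eq, posLabel, negLabel]
  ring

lemma integral_sq_projExcess_le (ρ : Measure (X × Label)) [IsFiniteMeasure ρ] {f : X → ℝ}
    (hf : Measurable f) : ∫ z, projExcess ρ f z ^ 2 ∂ρ ≤ 16 * projDist ρ f := by
  have hm := measurable_sq_clip_sub ρ hf
  calc ∫ z, projExcess ρ f z ^ 2 ∂ρ
      ≤ ∫ z, 16 * (clip (f z.1) - regressionFun ρ z.1) ^ 2 ∂ρ := by
        refine integral_mono_of_nonneg (Filter.Eventually.of_forall fun z => sq_nonneg _)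
          ((integrable_of_measurable_of_abs_le ρ (hm.comp measurable_fst)
            (fun z => abs_sq_clip_sub_le ρ f z.1)).const_mul 16)
          (Filter.Eventually.of_forall (sq_projExcess_le ρ f))
    _ = 16 * projDist ρ f := by
        rw [integral_const_mul]
        unfold projDist Measure.fst
        rw [integral_map measurable_fst.aemeasurable hm.aestronglyMeasurable]

lemma projDist_nonneg (ρ : Measure (X × Label)) [IsFiniteMeasure ρ] (f : X → ℝ) :
    0 ≤ projDist ρ f := integral_nonneg fun _ => sq_nonneg _

/-- Lets a uniform net of the class serve as a net of the clipped excess losses. -/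
lemma abs_projExcess_sub_le (ρ : Measure (X × Label)) [IsFiniteMeasure ρ] {f g : X → ℝ} {ε : ℝ}
    (h : ∀ x, |f x - g x| ≤ ε) (z : X × Label) :
    |projExcess ρ f z - projExcess ρ g z| ≤ 4 * ε := by
  rw [projExcess_eq, projExcess_eq]
  have h1 := clip_mem (f z.1)
  have h2 := clip_mem (g z.1)
  have h3 := (abs_clip_sub_clip_le (f z.1) (g z.1)).trans (h z.1)
  have h4 : ((z.2 : ℝ) - clip (f z.1)) ^ 2 - (z.2 - regressionFun ρ z.1) ^ 2
      - ((z.2 - clip (g z.1)) ^ 2 - (z.2 - regressionFun ρ z.1) ^ 2)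
      = (2 * z.2 - clip (f z.1) - clip (g z.1)) * (-(clip (f z.1) - clip (g z.1))) := by ring
  rw [h4, abs_mul, abs_neg]
  refine mul_le_mul ?_ h3 (abs_nonneg _) (by norm_num)
  rw [abs_le]
  rcases label_eq z.2 with h | h <;> rw [h] <;> constructor <;> linarith

lemma genError_eq_integral (ρ : Measure (X × Label)) [IsFiniteMeasure ρ] {f : X → ℝ}
    (hf : Measurable f) : genError sqHinge ρ f = ∫ z, sqHinge (z.2 * f z.1) ∂ρ := by
  unfold genError genErrorENN
  rw [integral_eq_lintegral_of_nonneg_ae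
    (Filter.Eventually.of_forall fun z => sqHinge_nonneg _)
    (measurable_label_mul hf).aestronglyMeasurable]

lemma genErrorENN_ne_top (ρ : Measure (X × Label)) [IsFiniteMeasure ρ] {f : X → ℝ} {B : ℝ}
    (hB : ∀ x, |f x| ≤ B) : genErrorENN sqHinge ρ f ≠ ⊤ := by
  unfold genErrorENN
  refine ((lintegral_mono (g := fun _ => ENNReal.ofReal ((1 + B) ^ 2)) fun z =>
    ENNReal.ofReal_le_ofReal ((le_abs_self _).trans (sqHinge_label_mul_le hB z))).trans_lt ?_).ne
  rw [lintegral_const]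
  exact ENNReal.mul_lt_top ENNReal.ofReal_lt_top (measure_lt_top _ _)

/-- Boundedness keeps the competitor's error finite; otherwise `toReal` would send it to 0 and the
comparison could fail. -/
lemma IsGenErrorMinimizer.genError_le {ρ : Measure (X × Label)} [IsFiniteMeasure ρ]
    {g f : X → ℝ} {B : ℝ} (hg : IsGenErrorMinimizer sqHinge ρ g) (hf : Measurable f)
    (hB : ∀ x, |f x| ≤ B) : genError sqHinge ρ g ≤ genError sqHinge ρ f :=
  ENNReal.toReal_mono (genErrorENN_ne_top ρ hB) (hg.2 f hf)

end Risk

/-! ### From `L²` distance to misclassification error. -/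

section Comparison

lemma sgnClassifier_eq_posLabel {X : Type*} {f : X → ℝ} {x : X} (h : 0 ≤ f x) :
    sgnClassifier f x = posLabel := if_pos h

lemma sgnClassifier_eq_negLabel {X : Type*} {f : X → ℝ} {x : X} (h : ¬ 0 ≤ f x) :
    sgnClassifier f x = negLabel := if_neg h

variable {X : Type*} [MeasurableSpace X]

lemma measurable_sgnClassifier {f : X → ℝ} (hf : Measurable f) :
    Measurable (sgnClassifier f) :=
  Measurable.ite (measurableSet_le measurable_const hf) measurable_const measurable_const

lemma measurableSet_misclassified {C : X → Label} (hC : Measurable C) :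
    MeasurableSet {z : X × Label | C z.1 ≠ z.2} :=
  (measurableSet_eq_fun (hC.comp measurable_fst) measurable_snd).compl

lemma misclassError_eq (ρ : Measure (X × Label)) [IsFiniteMeasure ρ] {f : X → ℝ}
    (hf : Measurable f) :
    misclassError ρ (sgnClassifier f)
      = ∫ x, (if 0 ≤ f x then (1 - regressionFun ρ x) / 2 else (1 + regressionFun ρ x) / 2)
          ∂ρ.fst := by
  have hS := measurableSet_misclassified (measurable_sgnClassifier hf)
  have h1 : misclassError ρ (sgnClassifier f)
      = ∫ z, Set.indicator {z : X × Label | sgnClassifier f z.1 ≠ z.2} (fun _ => (1 : ℝ)) z ∂ρ := by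
    rw [integral_indicator hS]
    simp [misclassError]
  rw [h1, integral_eq_integral_regressionFun ρ (c := 1) (measurable_const.indicator hS)]
  · congr 1
    funext x
    by_cases h : 0 ≤ f x
    · simp [Set.indicator, sgnClassifier_eq_posLabel h, h, posLabel_ne_negLabel]
    · simp [Set.indicator, sgnClassifier_eq_negLabel h, h, posLabel_ne_negLabel.symm]
  · intro z
    unfold Set.indicator
    split_ifs <;> simp

lemma misclassError_le_one (ρ : Measure (X × Label)) [IsProbabilityMeasure ρ] (C : X → Label) :
    misclassError ρ C ≤ 1 := measureReal_le_one

/-- Only a sign disagreement costs anything, and it costs at most `|η|`. If `|η| ≤ a`, the indicator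
pays. Otherwise `clip u` and `η` lie on opposite sides of 0, so `|η| ≤ |clip u - η|` and `a|η| ≤ η²
≤ (clip u - η)²`. -/
lemma misclass_integrand_le {u η a : ℝ} (ha : 0 < a) :
    (if 0 ≤ u then (1 - η) / 2 else (1 + η) / 2) - (if 0 ≤ η then (1 - η) / 2 else (1 + η) / 2)
      ≤ a * (if 0 < |η| ∧ |η| ≤ a then 1 else 0) + (clip u - η) ^ 2 / a := by
  have hsq : 0 ≤ (clip u - η) ^ 2 / a := div_nonneg (sq_nonneg _) ha.le
  have hind : 0 ≤ a * (if 0 < |η| ∧ |η| ≤ a then (1 : ℝ) else 0) :=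
    mul_nonneg ha.le (by split_ifs <;> norm_num)
  by_cases hsame : (0 ≤ u ↔ 0 ≤ η)
  · rw [if_congr hsame rfl rfl, sub_self]
    exact add_nonneg hind hsq
  · have hle : (if 0 ≤ u then (1 - η) / 2 else (1 + η) / 2)
        - (if 0 ≤ η then (1 - η) / 2 else (1 + η) / 2) ≤ |η| := by
      have h1 := le_abs_self η
      have h2 := neg_le_abs η
      split_ifs <;> linarith
    refine hle.trans ?_
    rcases (abs_nonneg η).eq_or_lt with h0 | h0
    · rw [← h0]; rw [← h0] at hind; exact add_nonneg hind hsq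
    · by_cases h1 : |η| ≤ a
      · rw [if_pos ⟨h0, h1⟩]; linarith
      · rw [if_neg (fun h => h1 h.2), mul_zero, zero_add, le_div_iff₀ ha]
        have h2 : |η| ≤ |clip u - η| := by
          unfold clip
          by_cases hu : 0 ≤ u
          · have hη0 : η < 0 := lt_of_not_ge fun h => hsame ⟨fun _ => h, fun _ => hu⟩
            rw [abs_of_neg hη0]
            refine le_trans ?_ (le_abs_self _)
            have : 0 ≤ max (-1) (min u 1) := le_max_of_le_right (le_min hu zero_le_one)
            linarith
          · have hη0 : 0 ≤ η := by
              by_contra h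
              exact hsame ⟨fun h' => absurd h' hu, fun h' => absurd h' h⟩
            rw [abs_of_nonneg hη0]
            refine le_trans ?_ (neg_le_abs _)
            have : max (-1) (min u 1) ≤ 0 :=
              max_le (by norm_num) ((min_le_left _ _).trans (le_of_not_ge hu))
            linarith
        rw [← sq_abs (clip u - η)]
        have h3 := mul_le_mul h2 h2 (abs_nonneg _) (abs_nonneg _)
        nlinarith [not_le.1 h1]

/-- The comparison theorem under Tsybakov's noise condition. -/
lemma misclassError_sub_le (ρ : Measure (X × Label)) [IsProbabilityMeasure ρ] {θ c : ℝ}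
    (hθ : 0 < θ) (hc : 0 < c) (hT : TsybakovNoise ρ θ c) {f : X → ℝ} (hf : Measurable f)
    {E : ℝ} (hE : 0 < E) (hfE : projDist ρ f ≤ E) :
    misclassError ρ (sgnClassifier f) - misclassError ρ (bayesRule ρ)
      ≤ (c + 1 / c) * E ^ ((1 + θ) / (2 + θ)) := by
  have hη := measurable_regressionFun ρ
  -- This threshold balances `t · t^θ` against `E / t`.
  set t : ℝ := E ^ (1 / (2 + θ)) with ht
  have htpos : 0 < t := Real.rpow_pos_of_pos hE _
  have hct : 0 < c * t := mul_pos hc htpos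
  set S : Set X := {x | 0 < |regressionFun ρ x| ∧ |regressionFun ρ x| ≤ c * t} with hS
  have habs : Measurable fun x => |regressionFun ρ x| := hη.abs
  have hSm : MeasurableSet S :=
    (measurableSet_lt measurable_const habs).inter (measurableSet_le habs measurable_const)
  have hint : ∀ {g : X → ℝ}, Measurable g →
      Integrable (fun x => if 0 ≤ g x then (1 - regressionFun ρ x) / 2
        else (1 + regressionFun ρ x) / 2) ρ.fst := by
    intro g hg
    refine integrable_of_measurable_of_abs_le ρ.fst (c := 1) (Measurable.ite
      (measurableSet_le measurable_const hg) ((measurable_const.sub hη).div_const 2)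
      ((measurable_const.add hη).div_const 2)) fun x => ?_
    have := regressionFun_mem ρ x
    rw [abs_le]
    split_ifs <;> constructor <;> linarith
  have hsq := integrable_of_measurable_of_abs_le ρ.fst (measurable_sq_clip_sub ρ hf)
    (abs_sq_clip_sub_le ρ f)
  have hSi : Integrable (S.indicator fun _ => (1 : ℝ)) ρ.fst :=
    (integrable_const _).indicator hSm
  rw [bayesRule_eq_sgnClassifier, misclassError_eq ρ hf, misclassError_eq ρ hη,
    ← integral_sub (hint hf) (hint hη)]
  calc _ ≤ ∫ x, (c * t * S.indicator (fun _ => (1 : ℝ)) x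
            + (clip (f x) - regressionFun ρ x) ^ 2 / (c * t)) ∂ρ.fst := by
        refine integral_mono ((hint hf).sub (hint hη))
          ((hSi.const_mul _).add (hsq.div_const _)) fun x => ?_
        have h := misclass_integrand_le (u := f x) (η := regressionFun ρ x) hct
        have hind : S.indicator (fun _ => (1 : ℝ)) x
            = if 0 < |regressionFun ρ x| ∧ |regressionFun ρ x| ≤ c * t then 1 else 0 := by
          by_cases hx : x ∈ S
          · rw [Set.indicator_of_mem hx]; exact (if_pos hx).symm
          · rw [Set.indicator_of_notMem hx]; exact (if_neg hx).symm
        rw [hind]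
        exact h
    _ = c * t * ρ.fst.real S + projDist ρ f / (c * t) := by
        rw [integral_add (hSi.const_mul _) (hsq.div_const _), integral_const_mul,
          integral_div, integral_indicator hSm]
        simp [projDist]
    _ ≤ c * t * t ^ θ + E / (c * t) := by
        refine add_le_add (mul_le_mul_of_nonneg_left (hT t htpos) hct.le) ?_
        gcongr
    _ = (c + 1 / c) * E ^ ((1 + θ) / (2 + θ)) := by
        have h2 : (2 + θ) ≠ 0 := by positivity
        have e1 : t * t ^ θ = E ^ ((1 + θ) / (2 + θ)) := by
          rw [ht, ← Real.rpow_mul hE.le, ← Real.rpow_add hE]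
          congr 1; field_simp
        have e2 : E / t = E ^ ((1 + θ) / (2 + θ)) := by
          have e3 : (1 + θ) / (2 + θ) = 1 - 1 / (2 + θ) := by field_simp; ring
          rw [e3, Real.rpow_sub hE, Real.rpow_one]
        rw [mul_assoc, e1, mul_comm c t, ← div_div, e2]
        ring

end Comparison

/-! ### The oracle inequality. -/

section Oracle

lemma sum_sqHinge_eq_mul_empError {X : Type*} {N : ℕ} (z : Fin N → X × Label) (f : X → ℝ) (hN : 0 < N) :
    ∑ i, sqHinge (((z i).2 : ℝ) * f (z i).1) = N * empError sqHinge z f := by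
  unfold empError
  field_simp

variable {X : Type*} [MeasurableSpace X]

/-- The excess loss of `f` over the regression function has a second moment controlled by its
mean. -/
lemma integral_sq_excess_le (ρ : Measure (X × Label)) [IsProbabilityMeasure ρ] {f : X → ℝ}
    {B : ℝ} (hf : Measurable f) (hB : ∀ x, |f x| ≤ B) :
    ∫ z, (sqHinge (z.2 * f z.1) - sqHinge (z.2 * regressionFun ρ z.1)) ^ 2 ∂ρ
      ≤ (2 * (1 + B) ^ 2 + 32)
        * ∫ z, (sqHinge (z.2 * f z.1) - sqHinge (z.2 * regressionFun ρ z.1)) ∂ρ := by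
  -- The excess loss is the gain `u` from clipping plus the clipped excess. The former is
  -- nonnegative and bounded, so its square is at most a constant times itself; the latter has its
  -- own second moment bound.
  set u : X × Label → ℝ := fun z => sqHinge (z.2 * f z.1) - sqHinge (z.2 * clip (f z.1)) with hu
  have hu0 : ∀ z, 0 ≤ u z := fun z => sub_nonneg.2 (sqHinge_label_mul_clip_le _ _)
  have hub : ∀ z, u z ≤ (1 + B) ^ 2 := fun z => by
    have h1 := (le_abs_self _).trans (sqHinge_label_mul_le hB z)
    have h2 := sqHinge_nonneg (z.2 * clip (f z.1))
    simp only [hu]; linarith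
  have hum : Measurable u :=
    (measurable_label_mul hf).sub (measurable_label_mul (measurable_clip.comp hf))
  have hui : Integrable u ρ := integrable_of_measurable_of_abs_le ρ hum fun z => by
    rw [abs_of_nonneg (hu0 z)]; exact hub z
  have hhm := measurable_projExcess ρ hf
  have hhi := integrable_of_measurable_of_abs_le ρ hhm (abs_projExcess_le ρ f)
  have hh2 : Integrable (fun z => projExcess ρ f z ^ 2) ρ :=
    integrable_of_measurable_of_abs_le ρ (c := 4 ^ 2) (hhm.pow_const 2) fun z => by
      rw [abs_pow]; exact pow_le_pow_left₀ (abs_nonneg _) (abs_projExcess_le ρ f z) 2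
  have hdec : ∀ z : X × Label, sqHinge (z.2 * f z.1) - sqHinge (z.2 * regressionFun ρ z.1)
      = u z + projExcess ρ f z := fun z => by simp only [hu, projExcess]; ring
  simp_rw [hdec]
  have hu_int : 0 ≤ ∫ z, u z ∂ρ := integral_nonneg hu0
  have hp := projDist_nonneg ρ f
  calc ∫ z, (u z + projExcess ρ f z) ^ 2 ∂ρ
      ≤ ∫ z, (2 * (1 + B) ^ 2 * u z + 2 * projExcess ρ f z ^ 2) ∂ρ := by
        refine integral_mono_of_nonneg (Filter.Eventually.of_forall fun z => sq_nonneg _)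
          ((hui.const_mul _).add (hh2.const_mul 2)) (Filter.Eventually.of_forall fun z => ?_)
        have h1 : u z * u z ≤ (1 + B) ^ 2 * u z := mul_le_mul_of_nonneg_right (hub z) (hu0 z)
        simp only
        nlinarith [sq_nonneg (u z - projExcess ρ f z)]
    _ = 2 * (1 + B) ^ 2 * ∫ z, u z ∂ρ + 2 * ∫ z, projExcess ρ f z ^ 2 ∂ρ := by
        rw [integral_add (hui.const_mul _) (hh2.const_mul 2), integral_const_mul,
          integral_const_mul]
    _ ≤ (2 * (1 + B) ^ 2 + 32) * (∫ z, u z ∂ρ + projDist ρ f) := by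
        have h1 := integral_sq_projExcess_le ρ hf
        have h2 := mul_nonneg (sq_nonneg (1 + B)) hp
        nlinarith
    _ = _ := by
        rw [integral_add hui hhi, integral_projExcess ρ hf]

/-- An oracle inequality for empirical risk minimization over a class with a finite net. -/
lemma oracle_inequality (ρ : Measure (X × Label)) [IsProbabilityMeasure ρ] {H : Set (X → ℝ)}
    {ι : Type*} [Fintype ι] [Nonempty ι] {G : ι → X → ℝ} (hG : ∀ j, Measurable (G j)) {ε : ℝ}
    (hHm : ∀ f ∈ H, Measurable f)
    (hnet : ∀ f ∈ H, ∃ j, ∀ x, |f x - G j x| ≤ ε) {f₀ : X → ℝ} (hf₀ : f₀ ∈ H) {B : ℝ}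
    (hB : ∀ x, |f₀ x| ≤ B) {N : ℕ} (hN : 0 < N) {δ : ℝ} (hδ : 0 < δ) :
    ∃ A : Set (Fin N → X × Label), MeasurableSet A ∧
      1 - δ ≤ (Measure.pi (fun _ : Fin N => ρ)).real A ∧
      ∀ z ∈ A, ∀ f, IsEmpMinimizer sqHinge z H f →
        projDist ρ f ≤ 4 * (genError sqHinge ρ f₀ - genError sqHinge ρ (regressionFun ρ))
          + 2 * (2 * (1 + B) ^ 2 + 32) * Real.log (2 / δ) / N
          + 64 * Real.log (2 * Fintype.card ι / δ) / N + 12 * ε := by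
  have hf₀m := hHm f₀ hf₀
  have hηm := measurable_regressionFun ρ
  set g : X × Label → ℝ :=
    fun z => sqHinge (z.2 * f₀ z.1) - sqHinge (z.2 * regressionFun ρ z.1) with hg
  set c : ℝ := 2 * (1 + B) ^ 2 + 32 with hc
  have hcpos : 0 < c := by positivity
  have hη1 : ∀ x, |regressionFun ρ x| ≤ 1 := fun x => abs_le.2 (regressionFun_mem ρ x)
  have hgm : Measurable g := (measurable_label_mul hf₀m).sub (measurable_label_mul hηm)
  have hgc : ∀ z, |g z| ≤ c := fun z => by
    have h1 := sqHinge_label_mul_le hB z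
    have h2 := sqHinge_label_mul_le hη1 z
    have h3 := abs_sub (sqHinge (z.2 * f₀ z.1)) (sqHinge (z.2 * regressionFun ρ z.1))
    simp only [hg]
    nlinarith [sq_nonneg (1 + B)]
  have hgint : ∫ z, g z ∂ρ = genError sqHinge ρ f₀ - genError sqHinge ρ (regressionFun ρ) := by
    rw [genError_eq_integral ρ hf₀m, genError_eq_integral ρ hηm]
    exact integral_sub
      (integrable_of_measurable_of_abs_le ρ (measurable_label_mul hf₀m) (sqHinge_label_mul_le hB))
      (integrable_of_measurable_of_abs_le ρ (measurable_label_mul hηm) (sqHinge_label_mul_le hη1))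
  set k : ℝ := (Fintype.card ι : ℝ) with hk
  have hkpos : 0 < k := by rw [hk]; exact_mod_cast Fintype.card_pos
  set s₂ := Real.log (2 / δ) with hs₂
  set s₁ := Real.log (2 * k / δ) with hs₁
  set P := Measure.pi (fun _ : Fin N => ρ) with hP
  -- Bad events. `U` concerns the single unclipped function `f₀`, so the bound `B` enters only
  -- there; the sets `V j` concern clipped net functions, with absolute constants. The budget is
  -- `δ/2` for `U` and `δ/(2k)` for each `V j`.
  set U : Set (Fin N → X × Label) :=
    {z | 2 * N * (∫ x, g x ∂ρ) + c * s₂ ≤ ∑ i, g (z i)} with hU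
  set V : ι → Set (Fin N → X × Label) := fun j =>
    {z | 2 * (∑ i, projExcess ρ (G j) (z i)) + 4 * 16 * s₁
      ≤ N * ∫ x, projExcess ρ (G j) x ∂ρ} with hV
  have hUm : MeasurableSet U := measurableSet_le measurable_const
    (Finset.measurable_sum _ fun i _ => hgm.comp (measurable_pi_apply i))
  have hVm : ∀ j, MeasurableSet (V j) := fun j => measurableSet_le
    (((Finset.measurable_sum _ fun i _ => (measurable_projExcess ρ (hG j)).comp
      (measurable_pi_apply i)).const_mul 2).add_const _) measurable_const
  have hUp : P.real U ≤ δ / 2 := by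
    refine (upper_deviation ρ hgm hcpos hgc (integral_sq_excess_le ρ hf₀m hB) N s₂).trans ?_
    rw [hs₂, ← Real.log_inv, Real.exp_log (by positivity)]
    simp
  have hVp : ∀ j, P.real (V j) ≤ δ / (2 * k) := fun j => by
    refine (lower_deviation ρ (measurable_projExcess ρ (hG j)) (c := 16) (by norm_num)
      (fun z => (abs_projExcess_le ρ (G j) z).trans (by norm_num)) ?_ N s₁).trans ?_
    · rw [integral_projExcess ρ (hG j)]
      exact integral_sq_projExcess_le ρ (hG j)
    · rw [hs₁, ← Real.log_inv, Real.exp_log (by positivity)]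
      simp
  refine ⟨(U ∪ ⋃ j, V j)ᶜ, (hUm.union (MeasurableSet.iUnion hVm)).compl, ?_, ?_⟩
  · rw [probReal_compl_eq_one_sub (hUm.union (MeasurableSet.iUnion hVm))]
    have h1 : P.real (⋃ j, V j) ≤ δ / 2 := by
      refine (measureReal_iUnion_fintype_le V).trans
        ((Finset.sum_le_sum fun j _ => hVp j).trans_eq ?_)
      rw [Finset.sum_const, nsmul_eq_mul, Finset.card_univ, ← hk]
      field_simp
    have h2 := measureReal_union_le (μ := P) U (⋃ j, V j)
    linarith
  · intro z hz f hf
    rw [Set.mem_compl_iff, Set.mem_union, Set.mem_iUnion, not_or, not_exists] at hz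
    obtain ⟨hzU, hzV⟩ := hz
    have hfm := hHm f hf.1
    obtain ⟨j, hj⟩ := hnet f hf.1
    have hNr : (0 : ℝ) < N := by exact_mod_cast hN
    have a1 : ∑ i, g (z i) < 2 * N * (∫ x, g x ∂ρ) + c * s₂ := not_le.1 hzU
    have a2 : N * ∫ x, projExcess ρ (G j) x ∂ρ
      < 2 * (∑ i, projExcess ρ (G j) (z i)) + 4 * 16 * s₁ := not_le.1 (hzV j)
    -- Empirical minimality compares the unclipped losses; clipping `f` only lowers its side.
    have a3 : ∑ i, projExcess ρ f (z i) ≤ ∑ i, g (z i) := by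
      have e1 := hf.2 f₀ hf₀
      have e2 : ∑ i, sqHinge (((z i).2 : ℝ) * f (z i).1)
          ≤ ∑ i, sqHinge (((z i).2 : ℝ) * f₀ (z i).1) := by
        rw [sum_sqHinge_eq_mul_empError z f hN, sum_sqHinge_eq_mul_empError z f₀ hN]
        exact mul_le_mul_of_nonneg_left e1 hNr.le
      have e3 : ∑ i, sqHinge (((z i).2 : ℝ) * clip (f (z i).1))
          ≤ ∑ i, sqHinge (((z i).2 : ℝ) * f (z i).1) :=
        Finset.sum_le_sum fun i _ => sqHinge_label_mul_clip_le _ _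
      simp only [projExcess, hg, Finset.sum_sub_distrib]
      linarith
    have a4 : ∑ i, projExcess ρ (G j) (z i) ≤ ∑ i, projExcess ρ f (z i) + N * (4 * ε) := by
      have : ∑ i, projExcess ρ (G j) (z i) ≤ ∑ i : Fin N, (projExcess ρ f (z i) + 4 * ε) :=
        Finset.sum_le_sum fun i _ => by
          linarith [(abs_le.1 (abs_projExcess_sub_le ρ hj (z i))).1]
      rw [Finset.sum_add_distrib] at this
      simpa using this
    have a5 : projDist ρ f ≤ ∫ x, projExcess ρ (G j) x ∂ρ + 4 * ε := by
      rw [← integral_projExcess ρ hfm]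
      have hGi := integrable_of_measurable_of_abs_le ρ (measurable_projExcess ρ (hG j))
        (abs_projExcess_le ρ (G j))
      have : ∫ x, projExcess ρ f x ∂ρ ≤ ∫ x, (projExcess ρ (G j) x + 4 * ε) ∂ρ :=
        integral_mono (integrable_of_measurable_of_abs_le ρ (measurable_projExcess ρ hfm)
          (abs_projExcess_le ρ f)) (hGi.add (integrable_const _)) fun x => by
            simp only
            linarith [(abs_le.1 (abs_projExcess_sub_le ρ hj x)).2]
      rw [integral_add hGi (integrable_const _)] at this
      simpa using this
    rw [← hgint]
    -- Moving to the net costs `8ε` in the doubled empirical sum and `4ε` in the mean.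
    have a6 : N * projDist ρ f ≤ N * (4 * ∫ z, g z ∂ρ) + 2 * c * s₂ + 64 * s₁ + N * (12 * ε) := by
      nlinarith [mul_le_mul_of_nonneg_left a5 hNr.le]
    have a7 : N * (4 * ∫ z, g z ∂ρ) + 2 * c * s₂ + 64 * s₁ + N * (12 * ε)
        = N * (4 * (∫ z, g z ∂ρ) + 2 * c * s₂ / N + 64 * s₁ / N + 12 * ε) := by
      field_simp
    rw [a7] at a6
    exact le_of_mul_le_mul_left a6 hNr

end Oracle

/-! ### A finite net of shallow networks. -/

section Net

/-- The equispaced grid with `2 Q + 1` points in `[-1, 1]`. -/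
noncomputable def gridPoint (Q : ℕ) (i : Fin (2 * Q + 1)) : ℝ := ((i : ℕ) - (Q : ℝ)) / Q

lemma abs_gridPoint_le (Q : ℕ) (i : Fin (2 * Q + 1)) : |gridPoint Q i| ≤ 1 := by
  unfold gridPoint
  rw [abs_div, abs_of_nonneg (Nat.cast_nonneg Q : (0 : ℝ) ≤ Q)]
  refine div_le_one_of_le₀ ?_ (Nat.cast_nonneg Q)
  have h : ((i : ℕ) : ℝ) ≤ 2 * Q := by exact_mod_cast Nat.lt_succ_iff.1 i.2
  have h0 : (0 : ℝ) ≤ (i : ℕ) := Nat.cast_nonneg _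
  rw [abs_le]
  constructor <;> linarith

lemma exists_gridPoint {Q : ℕ} (hQ : 0 < Q) {t : ℝ} (ht : |t| ≤ 1) :
    ∃ i, |t - gridPoint Q i| ≤ 1 / Q := by
  have hQr : (0 : ℝ) < Q := by exact_mod_cast hQ
  obtain ⟨h1, h2⟩ := abs_le.1 ht
  have h0 : 0 ≤ (t + 1) * Q := mul_nonneg (by linarith) hQr.le
  have hf1 := Nat.floor_le h0
  have hf2 := Nat.lt_floor_add_one ((t + 1) * Q)
  refine ⟨⟨⌊(t + 1) * Q⌋₊, ?_⟩, ?_⟩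
  · rw [Nat.lt_succ_iff]
    refine Nat.floor_le_of_le ?_
    push_cast
    nlinarith
  · unfold gridPoint
    have : t - ((⌊(t + 1) * Q⌋₊ : ℝ) - Q) / Q = ((t + 1) * Q - ⌊(t + 1) * Q⌋₊) / Q := by
      field_simp; ring
    simp only [this]
    rw [abs_of_nonneg (div_nonneg (by linarith) hQr.le)]
    gcongr
    linarith

lemma relu_nonneg (t : ℝ) : 0 ≤ relu t := le_max_right _ _

lemma abs_relu_sub_le (s t : ℝ) : |relu s - relu t| ≤ |s - t| :=
  abs_max_sub_max_le_abs s t 0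

lemma abs_cube_le {d : ℕ} (x : Cube d) (j : Fin d) : |(x : Fin d → ℝ) j| ≤ 1 :=
  abs_le.2 ⟨x.2.1 j, x.2.2 j⟩

lemma relu_neuron_le_one {d : ℕ} {α : Fin d → ℝ} (hα : ∑ j, |α j| ≤ 1) {b : ℝ} (hb : 0 ≤ b)
    (x : Cube d) : relu ((∑ j, α j * (x : Fin d → ℝ) j) - b) ≤ 1 := by
  refine max_le ?_ zero_le_one
  have : ∑ j, α j * (x : Fin d → ℝ) j ≤ ∑ j, |α j| := Finset.sum_le_sum fun j _ => by
    refine (le_abs_self _).trans ?_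
    rw [abs_mul]
    exact mul_le_of_le_one_right (abs_nonneg _) (abs_cube_le x j)
  linarith

/-- The shallow ReLU network with given weights. -/
noncomputable def shallowNet {d m : ℕ} (α : Fin m → Fin d → ℝ) (β b : Fin m → ℝ) (x : Cube d) :
    ℝ :=
  ∑ k, β k * relu ((∑ j, α k j * (x : Fin d → ℝ) j) - b k)

lemma measurable_shallowNet {d m : ℕ} (α : Fin m → Fin d → ℝ) (β b : Fin m → ℝ) :
    Measurable (shallowNet α β b) := by
  have h : Measurable relu := measurable_id.max measurable_const
  refine Finset.measurable_sum _ fun k _ => (h.comp ?_).const_mul _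
  refine (Finset.measurable_sum _ fun j _ => Measurable.const_mul ?_ _).sub_const _
  exact (measurable_pi_apply j).comp measurable_subtype_coe

/-- The bound on the outer weights in `hypothesisSpace`. -/
noncomputable def outerBound (d m : ℕ) (C₅ : ℝ) : ℝ :=
  4 * Real.pi ^ 2 * C₅ * (m : ℝ) ^ ((1 / 10 : ℝ) * (1 + 2 / (d : ℝ))) / (m : ℝ)

lemma outerBound_pos (d : ℕ) {m : ℕ} (hm : 0 < m) {C₅ : ℝ} (hC₅ : 0 < C₅) :
    0 < outerBound d m C₅ := by
  have : (0 : ℝ) < m := by exact_mod_cast hm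
  unfold outerBound
  have := Real.pi_pos
  positivity

lemma measurable_of_mem_hypothesisSpace {d m : ℕ} {C₅ : ℝ} {f : Cube d → ℝ}
    (hf : f ∈ hypothesisSpace d m C₅) : Measurable f := by
  obtain ⟨α, β, b, -, -, -, h⟩ := hf
  rw [show f = shallowNet α β b from funext h]
  exact measurable_shallowNet α β b

lemma abs_le_of_mem_hypothesisSpace {d m : ℕ} {C₅ : ℝ} {f : Cube d → ℝ}
    (hf : f ∈ hypothesisSpace d m C₅) (x : Cube d) : |f x| ≤ m * outerBound d m C₅ := by
  obtain ⟨α, β, b, hα, hb, hβ, h⟩ := hf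
  rw [h x]
  refine (Finset.abs_sum_le_sum_abs _ _).trans ?_
  have : ∑ k : Fin m, |β k * relu ((∑ j, α k j * (x : Fin d → ℝ) j) - b k)|
      ≤ ∑ _k : Fin m, outerBound d m C₅ := Finset.sum_le_sum fun k _ => by
    rw [abs_mul, abs_of_nonneg (relu_nonneg _)]
    exact (mul_le_of_le_one_right (abs_nonneg _) (relu_neuron_le_one (hα k) (hb k).1 x)).trans
      (hβ k)
  simpa using this

lemma zero_mem_hypothesisSpace (d : ℕ) {m : ℕ} (hm : 0 < m) {C₅ : ℝ} (hC₅ : 0 < C₅) :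
    (fun _ => 0) ∈ hypothesisSpace d m C₅ := by
  refine ⟨0, 0, 0, fun k => by simp, fun k => by simp, fun k => ?_, fun x => by simp⟩
  rw [Pi.zero_apply, abs_zero]
  exact (outerBound_pos d hm hC₅).le

/-- The index set of a finite net of the hypothesis space. -/
abbrev NetIndex (d m Q : ℕ) : Type :=
  Fin m → (Fin d → Fin (2 * Q + 1)) × Fin (2 * Q + 1) × Fin (2 * Q + 1)

/-- A finite net of the hypothesis space, obtained by discretizing all weights. -/
noncomputable def netFun {d m Q : ℕ} (w : ℝ) (i : NetIndex d m Q) : Cube d → ℝ :=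
  shallowNet (fun k j => gridPoint Q ((i k).1 j)) (fun k => w * gridPoint Q (i k).2.1)
    (fun k => gridPoint Q (i k).2.2)

lemma card_netIndex (d m Q : ℕ) :
    Fintype.card (NetIndex d m Q) = (2 * Q + 1) ^ (m * (d + 2)) := by
  simp only [Fintype.card_pi, Fintype.card_prod, Fintype.card_fin, Finset.prod_const,
    Finset.card_univ]
  rw [mul_comm m, pow_mul, pow_add, pow_two]

/-- Per neuron and up to the factor `w/Q`, the inner weights contribute `d`, the bias 1 and the
outer weight 1. The net functions need not belong to the class: their inner weights may violate the
`ℓ¹` constraint, so only the original neuron is bounded by 1. -/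
lemma exists_netFun_close {d m Q : ℕ} (hm : 0 < m) (hQ : 0 < Q) {C₅ : ℝ} (hC₅ : 0 < C₅)
    {f : Cube d → ℝ} (hf : f ∈ hypothesisSpace d m C₅) :
    ∃ i : NetIndex d m Q, ∀ x, |f x - netFun (outerBound d m C₅) i x|
      ≤ m * outerBound d m C₅ * (d + 2) / Q := by
  have hw := outerBound_pos d hm hC₅
  set w := outerBound d m C₅ with hwdef
  obtain ⟨α, β, b, hα, hb, hβ, h⟩ := hf
  have hQr : (0 : ℝ) < Q := by exact_mod_cast hQ
  have hα1 : ∀ k j, |α k j| ≤ 1 := fun k j =>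
    (Finset.single_le_sum (f := fun j => |α k j|) (fun _ _ => abs_nonneg _)
      (Finset.mem_univ j)).trans (hα k)
  choose iα hiα using fun k j => exists_gridPoint hQ (hα1 k j)
  choose iβ hiβ using fun k => exists_gridPoint hQ (t := β k / w) (by
    rw [abs_div, abs_of_pos hw]
    exact div_le_one_of_le₀ (hβ k) hw.le)
  choose ib hib using fun k => exists_gridPoint hQ (t := b k)
    (abs_le.2 ⟨by linarith [(hb k).1], (hb k).2⟩)
  refine ⟨fun k => (fun j => iα k j, iβ k, ib k), fun x => ?_⟩
  rw [h x]
  unfold netFun shallowNet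
  rw [← Finset.sum_sub_distrib]
  refine (Finset.abs_sum_le_sum_abs _ _).trans ?_
  have hk : ∀ k : Fin m, |β k * relu ((∑ j, α k j * (x : Fin d → ℝ) j) - b k)
      - w * gridPoint Q (iβ k)
        * relu ((∑ j, gridPoint Q (iα k j) * (x : Fin d → ℝ) j) - gridPoint Q (ib k))|
      ≤ w * (d + 2) / Q := by
    intro k
    set s := relu ((∑ j, α k j * (x : Fin d → ℝ) j) - b k) with hs
    set s' := relu ((∑ j, gridPoint Q (iα k j) * (x : Fin d → ℝ) j) - gridPoint Q (ib k)) with hs'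
    have e1 : |s| ≤ 1 := by
      rw [abs_of_nonneg (relu_nonneg _)]
      exact relu_neuron_le_one (hα k) (hb k).1 x
    have e2 : |s - s'| ≤ (d + 1) / Q := by
      refine (abs_relu_sub_le _ _).trans ?_
      have e3 : (∑ j, α k j * (x : Fin d → ℝ) j) - b k
          - ((∑ j, gridPoint Q (iα k j) * (x : Fin d → ℝ) j) - gridPoint Q (ib k))
          = ∑ j, (α k j - gridPoint Q (iα k j)) * (x : Fin d → ℝ) j
            - (b k - gridPoint Q (ib k)) := by
        simp only [sub_mul, Finset.sum_sub_distrib]; ring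
      rw [e3]
      refine (abs_sub _ _).trans ?_
      have e4 : |∑ j, (α k j - gridPoint Q (iα k j)) * (x : Fin d → ℝ) j| ≤ d * (1 / Q) := by
        refine (Finset.abs_sum_le_sum_abs _ _).trans ?_
        have : ∑ j, |(α k j - gridPoint Q (iα k j)) * (x : Fin d → ℝ) j|
            ≤ ∑ _j : Fin d, (1 / Q : ℝ) := Finset.sum_le_sum fun j _ => by
          rw [abs_mul]
          exact (mul_le_of_le_one_right (abs_nonneg _) (abs_cube_le x j)).trans (hiα k j)
        simpa using this
      have e5 := hib k
      have e6 : ((d : ℝ) + 1) / Q = d * (1 / Q) + 1 / Q := by ring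
      linarith
    have e7 : |β k - w * gridPoint Q (iβ k)| ≤ w * (1 / Q) := by
      have : β k - w * gridPoint Q (iβ k) = w * (β k / w - gridPoint Q (iβ k)) := by
        field_simp
      rw [this, abs_mul, abs_of_pos hw]
      exact mul_le_mul_of_nonneg_left (hiβ k) hw.le
    have e8 : |w * gridPoint Q (iβ k)| ≤ w := by
      rw [abs_mul, abs_of_pos hw]
      exact mul_le_of_le_one_right hw.le (abs_gridPoint_le _ _)
    have e9 : β k * s - w * gridPoint Q (iβ k) * s'
        = (β k - w * gridPoint Q (iβ k)) * s + w * gridPoint Q (iβ k) * (s - s') := by ring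
    rw [e9]
    refine (abs_add_le _ _).trans ?_
    rw [abs_mul, abs_mul]
    have e10 := mul_le_mul e7 e1 (abs_nonneg _) (by positivity)
    have e11 := mul_le_mul e8 e2 (abs_nonneg _) hw.le
    refine (add_le_add e10 e11).trans_eq ?_
    ring
  refine (Finset.sum_le_sum fun k _ => hk k).trans_eq ?_
  rw [Finset.sum_const, Finset.card_univ, Fintype.card_fin, nsmul_eq_mul]
  ring

end Net

/-! ### Sample size and rate arithmetic. -/

section Rates

/-- With `x = m^q` the unrounded size, `m/x`, `x^(-r)` and the approximation rate coincide. Since `x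
≥ 1`, rounding changes `x` by a factor of at most 2. -/
lemma sampleSize_estimates {d κ : ℝ} (hd : 0 < d) (hκ : 0 ≤ κ) {m N : ℕ} (hm : 0 < m)
    (hN : N = ⌊(m : ℝ) ^ ((9 * d + 8 + κ) / (5 * d + κ))⌋₊ ∨
      N = ⌈(m : ℝ) ^ ((9 * d + 8 + κ) / (5 * d + κ))⌉₊) :
    0 < N ∧ (m : ℝ) ≤ 2 * N ∧
      (m : ℝ) / N ≤ 4 * (N : ℝ) ^ (-((4 * d + 8) / (9 * d + 8 + κ))) ∧
      (m : ℝ) ^ (-((4 * d + 8) / (5 * d + κ)))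
        ≤ 2 * (N : ℝ) ^ (-((4 * d + 8) / (9 * d + 8 + κ))) := by
  have hm1 : (1 : ℝ) ≤ m := by exact_mod_cast hm
  have hm0 : (0 : ℝ) < m := by linarith
  set q := (9 * d + 8 + κ) / (5 * d + κ) with hq
  set r := (4 * d + 8) / (9 * d + 8 + κ) with hr
  have h5 : 0 < 5 * d + κ := by positivity
  have h9 : 0 < 9 * d + 8 + κ := by positivity
  have hq1 : 1 ≤ q := by rw [hq, le_div_iff₀ h5]; linarith
  have hr0 : 0 < r := by positivity
  have hr1 : r ≤ 1 := by rw [hr, div_le_one h9]; linarith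
  set x : ℝ := (m : ℝ) ^ q with hx
  have hmx : (m : ℝ) ≤ x := by
    have := Real.rpow_le_rpow_of_exponent_le hm1 hq1
    rwa [Real.rpow_one] at this
  have hx1 : 1 ≤ x := hm1.trans hmx
  have hx0 : 0 < x := by linarith
  have hNx : 0 < N ∧ x ≤ 2 * N ∧ (N : ℝ) ≤ 2 * x := by
    rcases hN with h | h
    · have h1 : 1 ≤ N := by rw [h]; exact Nat.one_le_floor_iff x |>.2 hx1
      have h1r : (1 : ℝ) ≤ N := by exact_mod_cast h1
      have h2 : x < N + 1 := by rw [h]; exact Nat.lt_floor_add_one x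
      have h3 : (N : ℝ) ≤ x := by rw [h]; exact Nat.floor_le hx0.le
      exact ⟨h1, by linarith, by linarith⟩
    · have h2 : x ≤ N := by rw [h]; exact Nat.le_ceil x
      have h3 : (N : ℝ) < x + 1 := by rw [h]; exact Nat.ceil_lt_add_one hx0.le
      have h1 : (0 : ℝ) < N := by linarith
      exact ⟨by exact_mod_cast h1, by linarith, by linarith⟩
  obtain ⟨hN0, hxN, hNx⟩ := hNx
  have hNr : (0 : ℝ) < N := by exact_mod_cast hN0
  have hxr : x ^ (-r) ≤ 2 * (N : ℝ) ^ (-r) := by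
    have h1 : x ^ (-r) ≤ ((N : ℝ) / 2) ^ (-r) :=
      Real.rpow_le_rpow_of_nonpos (by positivity) (by linarith) (by linarith)
    rw [Real.div_rpow hNr.le (by norm_num), div_eq_mul_inv, ← Real.rpow_neg (by norm_num),
      neg_neg, mul_comm] at h1
    refine h1.trans (mul_le_mul_of_nonneg_right ?_ (by positivity))
    have := Real.rpow_le_rpow_of_exponent_le (one_le_two) hr1
    rwa [Real.rpow_one] at this
  have hqr : (m : ℝ) ^ (-((4 * d + 8) / (5 * d + κ))) = x ^ (-r) := by
    rw [hx, ← Real.rpow_mul hm0.le]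
    congr 1
    rw [hq, hr]; field_simp
  have hmdx : (m : ℝ) / x = x ^ (-r) := by
    rw [← hqr, hx]
    nth_rewrite 1 [← Real.rpow_one (m : ℝ)]
    rw [← Real.rpow_sub hm0]
    congr 1
    rw [hq]; field_simp; ring
  refine ⟨hN0, by linarith, ?_, by rw [hqr]; exact hxr⟩
  calc (m : ℝ) / N ≤ m / (x / 2) := by gcongr; linarith
    _ = 2 * (m / x) := by field_simp
    _ ≤ 4 * (N : ℝ) ^ (-r) := by rw [hmdx]; linarith

lemma mul_mul_mul_mul_le {C a a' b b' t t' F : ℝ} (hC : 0 ≤ C) (ha : 0 ≤ a) (haa : a ≤ a')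
    (hb : 0 ≤ b) (hbb : b ≤ b') (ht : 0 ≤ t) (htt : t ≤ t') (hF : 0 ≤ F) :
    C * a * b * t * F ≤ C * a' * b' * t' * F := by
  have h1 : 0 ≤ a' := ha.trans haa
  have h2 : 0 ≤ b' := hb.trans hbb
  gcongr

/-- Conversion of a bound on the excess risk with respect to the loss into the final rate. -/
lemma rate_of_excess_bound {θ C A r r₀ Cp l D R : ℝ} {N : ℕ} (hθ : 0 < θ) (hC : 1 ≤ C)
    (hA : 1 ≤ A) (hr₀ : 0 < r₀) (hr : r₀ ≤ r) (hCp : 0 ≤ Cp) (hN : 0 < N)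
    (hl : Real.log 2 ≤ l) (hD : max 1 Cp * ((Real.log N + l) * l) ≤ D) (hR1 : R ≤ 1)
    (hR : R ≤ C * (A * (Cp + (Real.log N + l)) * (N : ℝ) ^ (-r)) ^ ((1 + θ) / (2 + θ))) :
    R ≤ C * (16 * A + 16 * A * ((2 + θ) / r₀)) * max 1 Cp ^ max 0 (θ / (2 + θ) - 1 / 2)
      * √D * (N : ℝ) ^ (-(θ / (2 + θ) * r)) := by
  have hNr : (1 : ℝ) ≤ N := by exact_mod_cast hN
  have hN0 : (0 : ℝ) < N := by linarith
  have hlogN : 0 ≤ Real.log N := Real.log_nonneg hNr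
  have hlog2 : (1 / 2 : ℝ) ≤ l := by linarith [Real.log_two_gt_d9]
  set V := max 1 Cp with hV
  have hV1 : 1 ≤ V := le_max_left _ _
  set l' := Real.log N + l with hl'
  have hll' : l ≤ l' := by linarith
  set s := θ / (2 + θ) with hs
  set s' := (1 + θ) / (2 + θ) with hs'
  have h2θ : 0 < 2 + θ := by linarith
  have hs0 : 0 < s := by positivity
  have hs'0 : 0 < s' := by positivity
  have hss' : s ≤ s' := by rw [hs, hs']; gcongr; linarith
  have hs'1 : s' ≤ 1 := by rw [hs', div_le_one h2θ]; linarith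
  set E := A * (Cp + l') * (N : ℝ) ^ (-r) with hE
  have hNr_pos : 0 < (N : ℝ) ^ (-r) := Real.rpow_pos_of_pos hN0 _
  have hE0 : 0 < E := by
    have : 0 < Cp + l' := by linarith
    positivity
  -- For `E ≥ 1` the trivial bound `R ≤ 1 ≤ C` suffices; for `E ≤ 1` lowering the exponent weakens
  -- the bound.
  have hRs : R ≤ C * E ^ s := by
    rcases le_total 1 E with h | h
    · have := Real.one_le_rpow h hs0.le
      nlinarith
    · exact hR.trans (mul_le_mul_of_nonneg_left
        (Real.rpow_le_rpow_of_exponent_ge hE0 h hss') (by linarith))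
  have hNs : ∀ u : ℝ, ((N : ℝ) ^ (-r)) ^ u = (N : ℝ) ^ (-(u * r)) := fun u => by
    rw [← Real.rpow_mul hN0.le]; congr 1; ring
  have hpow : ∀ {a u : ℝ}, 1 ≤ a → u ≤ 1 → a ^ u ≤ a := fun {a u} ha hu => by
    have := Real.rpow_le_rpow_of_exponent_le ha hu
    rwa [Real.rpow_one] at this
  set T := √(l' * l) with hT
  have hTl : l ≤ T := Real.le_sqrt_of_sq_le (by rw [sq]; gcongr)
  have hT0 : 1 / 2 ≤ T := hlog2.trans hTl
  set W := V ^ max 0 (s - 1 / 2) with hW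
  -- `√D` supplies only `√V`; when `s > 1/2`, that is `θ > 2`, the factor `W` makes up the rest.
  have hWV : V ^ s ≤ W * √V := by
    rw [hW, Real.sqrt_eq_rpow, ← Real.rpow_add (by linarith)]
    exact Real.rpow_le_rpow_of_exponent_le hV1 (by linarith [le_max_right 0 (s - 1 / 2)])
  have hW1 : 1 ≤ W * √V := (Real.one_le_rpow hV1 hs0.le).trans hWV
  have hW0 : 0 ≤ W := by positivity
  have hDT : √V * T ≤ √D := by
    rw [hT, ← Real.sqrt_mul (by linarith)]
    exact Real.sqrt_le_sqrt hD
  set F := (N : ℝ) ^ (-(s * r)) with hF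
  have hF0 : 0 < F := Real.rpow_pos_of_pos hN0 _
  have hθr : 0 < (2 + θ) / r₀ := by positivity
  have hA0 : 0 < A := by linarith
  have hC0 : 0 ≤ C := by linarith
  have hAθ : 0 < 16 * A * ((2 + θ) / r₀) := by positivity
  have hWV0 : 0 ≤ W * √V := by linarith
  have hKA : 0 ≤ C * (16 * A + 16 * A * ((2 + θ) / r₀)) * W := by positivity
  -- Three cases, by the dominant term among `Cp`, `l` and `log N`. The exponent `s` suffices in the
  -- first two, since `l ≤ T`. In the last the full exponent `s'` is needed: `γ = (s' - s) r` is the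
  -- spare power of `N`, spent on `log N ≤ N^γ / γ`.
  have hkey : R ≤ C * (16 * A + 16 * A * ((2 + θ) / r₀)) * (W * √V) * T * F := by
    rcases le_total l' Cp with h | h
    · have h1 : E ≤ 2 * A * V * (N : ℝ) ^ (-r) := by
        rw [hE]
        refine mul_le_mul_of_nonneg_right ?_ hNr_pos.le
        have : Cp ≤ V := le_max_right _ _
        nlinarith
      have h2 : E ^ s ≤ 2 * A * V ^ s * F := by
        refine (Real.rpow_le_rpow hE0.le h1 hs0.le).trans ?_
        rw [Real.mul_rpow (by positivity) hNr_pos.le, Real.mul_rpow (by positivity) (by linarith),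
          hNs]
        gcongr
        exact hpow (by linarith) (hss'.trans hs'1)
      calc R ≤ C * (2 * A * V ^ s * F) := hRs.trans (mul_le_mul_of_nonneg_left h2 hC0)
        _ ≤ C * (2 * A * (W * √V) * F) := mul_le_mul_of_nonneg_left
            (mul_le_mul_of_nonneg_right (mul_le_mul_of_nonneg_left hWV (by linarith)) hF0.le) hC0
        _ = C * (4 * A) * (W * √V) * (1 / 2) * F := by ring
        _ ≤ C * (16 * A + 16 * A * ((2 + θ) / r₀)) * (W * √V) * T * F :=
            mul_mul_mul_mul_le hC0 (by linarith) (by linarith) hWV0 le_rfl (by norm_num) hT0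
              hF0.le
    · have h1 : E ≤ (2 * A) * (2 * l') * (N : ℝ) ^ (-r) := by
        rw [hE]
        refine mul_le_mul_of_nonneg_right ?_ hNr_pos.le
        nlinarith
      have h2 : ∀ u, 0 < u → u ≤ 1 → E ^ u ≤ (2 * A) * (2 * l') * (N : ℝ) ^ (-(u * r)) := by
        intro u hu0 hu1
        refine (Real.rpow_le_rpow hE0.le h1 hu0.le).trans ?_
        rw [Real.mul_rpow (by positivity) hNr_pos.le, hNs]
        gcongr
        exact hpow (one_le_mul_of_one_le_of_one_le (by linarith) (by linarith)) hu1
      rcases le_total (Real.log N) l with h3 | h3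
      · have h4 : l' ≤ 2 * T := by linarith
        calc R ≤ C * ((2 * A) * (2 * l') * F) :=
              hRs.trans (mul_le_mul_of_nonneg_left (h2 s hs0 (hss'.trans hs'1)) hC0)
          _ ≤ C * ((2 * A) * (2 * (2 * T)) * F) := by gcongr
          _ = C * (8 * A) * 1 * T * F := by ring
          _ ≤ C * (16 * A + 16 * A * ((2 + θ) / r₀)) * (W * √V) * T * F :=
              mul_mul_mul_mul_le hC0 (by linarith) (by linarith) zero_le_one hW1 (by linarith)
                le_rfl hF0.le
      · set γ := r / (2 + θ) with hγ
        have hr0 : 0 < r := by linarith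
        have hγ0 : 0 < γ := by positivity
        have h4 : l' ≤ 2 * ((N : ℝ) ^ γ * ((2 + θ) / r₀)) := by
          have h5 := Real.log_le_rpow_div hN0.le hγ0
          have h6 : (N : ℝ) ^ γ / γ ≤ (N : ℝ) ^ γ * ((2 + θ) / r₀) := by
            rw [div_eq_mul_inv, hγ, inv_div]
            gcongr
          linarith
        have h7 : (N : ℝ) ^ γ * (N : ℝ) ^ (-(s' * r)) = F := by
          rw [← Real.rpow_add hN0, hF]
          congr 1
          rw [hγ, hs, hs']; field_simp; ring
        calc R ≤ C * ((2 * A) * (2 * l') * (N : ℝ) ^ (-(s' * r))) :=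
              hR.trans (mul_le_mul_of_nonneg_left (h2 s' hs'0 hs'1) hC0)
          _ ≤ C * ((2 * A) * (2 * (2 * ((N : ℝ) ^ γ * ((2 + θ) / r₀))))
                * (N : ℝ) ^ (-(s' * r))) := by gcongr
          _ = C * (16 * A * ((2 + θ) / r₀)) * 1 * (1 / 2)
                * ((N : ℝ) ^ γ * (N : ℝ) ^ (-(s' * r))) := by ring
          _ ≤ C * (16 * A + 16 * A * ((2 + θ) / r₀)) * (W * √V) * T * F := by
              rw [h7]
              exact mul_mul_mul_mul_le hC0 hAθ.le (by linarith) zero_le_one hW1 (by norm_num) hT0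
                hF0.le
  calc R ≤ C * (16 * A + 16 * A * ((2 + θ) / r₀)) * (W * √V) * T * F := hkey
    _ = C * (16 * A + 16 * A * ((2 + θ) / r₀)) * W * (√V * T) * F := by ring
    _ ≤ _ := mul_le_mul_of_nonneg_right (mul_le_mul_of_nonneg_left hDT hKA) hF0.le

end Rates

/-! ### Assembling the excess risk bound. -/

section Assembly

/-- The constant in the bound for the excess risk with respect to the loss. -/
noncomputable def excessConst (a D : ℝ) : ℝ :=
  4 * (104 + 8 * a ^ 2 + 64 * (D * (2 * Real.log (4 * a * D + 3) + 2) + 1))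

lemma eight_le_excessConst {a D : ℝ} (ha : 0 ≤ a) (hD : 0 ≤ D) : 8 ≤ excessConst a D := by
  unfold excessConst
  have h1 : 0 ≤ Real.log (4 * a * D + 3) := Real.log_nonneg (by nlinarith [mul_nonneg ha hD])
  have h2 : 0 ≤ D * (2 * Real.log (4 * a * D + 3) + 2) := by positivity
  nlinarith [sq_nonneg a]

lemma log_netSize_le {a D M : ℝ} {m N : ℕ} (ha : 0 < a) (hD : 0 ≤ D) (hN : 0 < N)
    (hmN : (m : ℝ) ≤ 2 * N) (hM : 0 ≤ M) (hMa : M ≤ a * m) :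
    Real.log (2 * (⌈M * D * N⌉₊ : ℕ) + 1) ≤ Real.log (4 * a * D + 3) + 2 * Real.log N := by
  have hNr : (1 : ℝ) ≤ N := by exact_mod_cast hN
  have hN0 : (0 : ℝ) < N := by linarith
  have haD : 0 ≤ a * D := mul_nonneg ha.le hD
  have h1 : (⌈M * D * N⌉₊ : ℝ) < M * D * N + 1 := Nat.ceil_lt_add_one (by positivity)
  have h2 : M ≤ 2 * a * N := by nlinarith
  have h3 : M * D * N ≤ 2 * a * N * D * N := by gcongr
  have h4 : (1 : ℝ) ≤ (N : ℝ) ^ 2 := one_le_pow₀ hNr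
  have h5 : 2 * (⌈M * D * N⌉₊ : ℝ) + 1 ≤ (4 * a * D + 3) * (N : ℝ) ^ 2 := by nlinarith
  have h6 := Real.log_le_log (by positivity) h5
  rwa [Real.log_mul (by positivity) (by positivity), Real.log_pow, Nat.cast_ofNat] at h6

/-- Every term except `Cp * y` is at most a constant times `(log N + l) m / N`. In particular `M² ≤
a² m` absorbs the squared sup bound, and the grid size `⌈M D N⌉` makes the net radius at most `1/N`.
-/
lemma error_terms_le {a D M Δ Cp y n l : ℝ} {m N : ℕ} (ha : 0 < a) (hD : 0 < D)
    (hN : 0 < N) (hm : 0 < m) (hmN : (m : ℝ) ≤ 2 * N) (hM : 0 < M) (hMa : M ≤ a * m)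
    (hMa2 : M ^ 2 ≤ a ^ 2 * m) (hl : Real.log 2 ≤ l) (hCp : 0 ≤ Cp) (hn : (m : ℝ) / N ≤ 4 * n)
    (hy : y ≤ 2 * n) (hΔ : Δ ≤ Cp * y + 1 / N) :
    4 * Δ + 2 * (2 * (1 + M) ^ 2 + 32) * l / N
      + 64 * (m * D * Real.log (2 * (⌈M * D * N⌉₊ : ℕ) + 1) + l) / N
      + 12 * (M * D / (⌈M * D * N⌉₊ : ℕ))
      ≤ excessConst a D * (Cp + (Real.log N + l)) * n := by
  have hNr : (1 : ℝ) ≤ N := by exact_mod_cast hN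
  have hmr : (1 : ℝ) ≤ m := by exact_mod_cast hm
  have hN0 : (0 : ℝ) < N := by linarith
  have hlogN : 0 ≤ Real.log N := Real.log_nonneg hNr
  have hl2 : (1 / 2 : ℝ) ≤ l := by linarith [Real.log_two_gt_d9]
  set L := Real.log N + l with hL
  have hlL : l ≤ L := by linarith
  have hL2 : 1 ≤ 2 * L := by linarith
  set b := Real.log (4 * a * D + 3) with hb
  have hb0 : 0 ≤ b := Real.log_nonneg (by nlinarith [mul_pos ha hD])
  set g := Real.log (2 * (⌈M * D * N⌉₊ : ℕ) + 1) with hg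
  have hgL : g ≤ (2 * b + 2) * L := by
    have := log_netSize_le ha hD.le hN hmN hM.le hMa
    nlinarith
  set ρ := (m : ℝ) / N with hρ
  have hρ0 : 0 < ρ := by positivity
  have h1N : 1 / (N : ℝ) ≤ ρ := by rw [hρ]; gcongr
  have t1 : 4 * Δ ≤ 8 * (Cp * n) + 4 * ρ := by
    have := mul_le_mul_of_nonneg_left hy hCp
    linarith
  have t2 : 2 * (2 * (1 + M) ^ 2 + 32) * l / N ≤ (72 + 8 * a ^ 2) * (L * ρ) := by
    have e1 : 2 * (2 * (1 + M) ^ 2 + 32) ≤ (72 + 8 * a ^ 2) * m := by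
      nlinarith [sq_nonneg (1 - M)]
    calc 2 * (2 * (1 + M) ^ 2 + 32) * l / N ≤ (72 + 8 * a ^ 2) * m * L / N := by gcongr
      _ = _ := by rw [hρ]; ring
  have t3 : 64 * (m * D * g + l) / N ≤ 64 * (D * (2 * b + 2) + 1) * (L * ρ) := by
    have e1 : m * D * g + l ≤ m * D * ((2 * b + 2) * L) + m * L := by
      have e2 : m * D * g ≤ m * D * ((2 * b + 2) * L) := by gcongr
      nlinarith
    calc 64 * (m * D * g + l) / N ≤ 64 * (m * D * ((2 * b + 2) * L) + m * L) / N := by gcongr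
      _ = _ := by rw [hρ]; ring
  have t4 : 12 * (M * D / (⌈M * D * N⌉₊ : ℕ)) ≤ 12 * ρ := by
    have e1 : M * D * N ≤ (⌈M * D * N⌉₊ : ℝ) := Nat.le_ceil _
    have e0 : 0 < M * D * N := by positivity
    have e2 : M * D / (⌈M * D * N⌉₊ : ℝ) ≤ 1 / N := by
      rw [div_le_div_iff₀ (by linarith) hN0]; linarith
    linarith
  have hLρ : ρ ≤ 2 * (L * ρ) := by nlinarith
  have hDb : 0 ≤ D * (2 * b + 2) := by positivity
  have hK : 0 ≤ 104 + 8 * a ^ 2 + 64 * (D * (2 * b + 2) + 1) := by positivity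
  have hLρn : L * ρ ≤ L * (4 * n) := by gcongr
  have hsum : 4 * Δ + 2 * (2 * (1 + M) ^ 2 + 32) * l / N + 64 * (m * D * g + l) / N
      + 12 * (M * D / (⌈M * D * N⌉₊ : ℕ))
      ≤ 8 * (Cp * n) + (104 + 8 * a ^ 2 + 64 * (D * (2 * b + 2) + 1)) * (L * ρ) := by linarith
  refine hsum.trans ?_
  have hn0 : 0 ≤ n := by linarith
  have h8 := mul_le_mul_of_nonneg_right (eight_le_excessConst ha.le hD.le) (mul_nonneg hCp hn0)
  have h9 := mul_le_mul_of_nonneg_left hLρn hK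
  have h10 : excessConst a D * (Cp + L) * n = excessConst a D * (Cp * n)
      + (104 + 8 * a ^ 2 + 64 * (D * (2 * b + 2) + 1)) * (L * (4 * n)) := by
    unfold excessConst; rw [← hb]; ring
  rw [h10]
  linarith

/-- The exponent `(1 + 2/d)/10` is at most `3/10`, so even the square of the sup bound grows no
faster than `m`. -/
lemma mul_outerBound_le {d m : ℕ} (hd : 0 < d) (hm : 0 < m) {C₅ : ℝ} (hC₅ : 0 < C₅) :
    m * outerBound d m C₅ ≤ 4 * Real.pi ^ 2 * C₅ * m ∧
      (m * outerBound d m C₅) ^ 2 ≤ (4 * Real.pi ^ 2 * C₅) ^ 2 * m := by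
  have hdr : (1 : ℝ) ≤ d := by exact_mod_cast hd
  have hmr : (1 : ℝ) ≤ m := by exact_mod_cast hm
  have hm0 : (0 : ℝ) < m := by linarith
  have hpi := Real.pi_pos
  set e := (1 / 10 : ℝ) * (1 + 2 / (d : ℝ)) with he
  have h2d : 2 / (d : ℝ) ≤ 2 := div_le_self zero_le_two hdr
  have he1 : e ≤ 1 := by linarith
  have he2 : e * (2 : ℕ) ≤ 1 := by push_cast; linarith
  have hM : m * outerBound d m C₅ = 4 * Real.pi ^ 2 * C₅ * (m : ℝ) ^ e := by
    rw [outerBound, ← he, mul_comm, div_mul_cancel₀ _ hm0.ne']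
  have hpow : ∀ {u : ℝ}, u ≤ 1 → (m : ℝ) ^ u ≤ m := fun {u} hu => by
    have := Real.rpow_le_rpow_of_exponent_le hmr hu
    rwa [Real.rpow_one] at this
  rw [hM, mul_pow, ← Real.rpow_natCast ((m : ℝ) ^ e), ← Real.rpow_mul hm0.le]
  exact ⟨by gcongr; exact hpow he1, by gcongr; exact hpow he2⟩

lemma pTerm_mem (d : ℕ) {p : ENNReal} (hp : 1 ≤ p) : 0 ≤ pTerm d p ∧ pTerm d p ≤ (d : ℝ) ^ 2 := by
  unfold pTerm
  split_ifs with h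
  · exact ⟨le_rfl, by positivity⟩
  · have hp2 : p < 2 := not_le.1 h
    have htop : p ≠ ⊤ := ne_top_of_lt hp2
    have h1 : 1 ≤ p.toReal := by
      have := ENNReal.toReal_mono htop hp
      simpa using this
    have h2 : p.toReal ≤ 2 := by
      have := ENNReal.toReal_mono (by simp) hp2.le
      simpa using this
    have h3 : 1 ≤ 2 / p.toReal := by rw [le_div_iff₀ (by linarith)]; linarith
    have h4 : 2 / p.toReal ≤ 2 := div_le_self zero_le_two h1
    have h5 : (0 : ℝ) ≤ (d : ℝ) ^ 2 := by positivity
    constructor <;> nlinarith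

lemma lossBound_nonneg {X : Type*} (φ : ℝ → ℝ) (H : Set (X → ℝ)) : 0 ≤ lossBound φ H := by
  refine Real.sSup_nonneg ?_
  rintro _ ⟨v, -, rfl⟩
  exact abs_nonneg _

lemma approxError_nonneg {d m : ℕ} {C₅ : ℝ} (ρ : Measure (Cube d × Label))
    [IsProbabilityMeasure ρ] {g : Cube d → ℝ} (hg : IsGenErrorMinimizer sqHinge ρ g) :
    0 ≤ approxError sqHinge ρ (hypothesisSpace d m C₅) g := by
  refine Real.sInf_nonneg ?_
  rintro _ ⟨f, hf, rfl⟩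
  exact sub_nonneg.2 (hg.genError_le (measurable_of_mem_hypothesisSpace hf)
    (abs_le_of_mem_hypothesisSpace hf))

/-- The excess risk bound, with respect to the loss, for empirical risk minimization over shallow
networks. -/
lemma excess_rate {d : ℕ} (hd : 0 < d) {C₅ : ℝ} (hC₅ : 0 < C₅) {κ : ℝ} (hκ : 0 ≤ κ)
    (ρ : Measure (Cube d × Label)) [IsProbabilityMeasure ρ] {g : Cube d → ℝ} {Cp δ : ℝ} {m N : ℕ}
    (hg : IsGenErrorMinimizer sqHinge ρ g) (hm : 0 < m)
    (happ : approxError sqHinge ρ (hypothesisSpace d m C₅) g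
      ≤ Cp * (m : ℝ) ^ (-((4 * d + 8) / (5 * d + κ))))
    (hN : N = ⌊(m : ℝ) ^ ((9 * d + 8 + κ) / (5 * d + κ))⌋₊ ∨
      N = ⌈(m : ℝ) ^ ((9 * d + 8 + κ) / (5 * d + κ))⌉₊)
    (hCp : 0 ≤ Cp) (hδ : 0 < δ) (hδ1 : δ < 1) :
    ∃ A : Set (Fin N → Cube d × Label), MeasurableSet A ∧
      1 - δ ≤ (Measure.pi (fun _ : Fin N => ρ)).real A ∧
      ∀ z ∈ A, ∀ f, IsEmpMinimizer sqHinge z (hypothesisSpace d m C₅) f →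
        projDist ρ f ≤ excessConst (4 * Real.pi ^ 2 * C₅) (d + 2)
          * (Cp + (Real.log N + Real.log (2 / δ)))
          * (N : ℝ) ^ (-((4 * d + 8) / (9 * d + 8 + κ))) := by
  have hdr : (0 : ℝ) < d := by exact_mod_cast hd
  obtain ⟨hN0, hmN, hmN', hmr⟩ := sampleSize_estimates hdr hκ hm hN
  have hNr : (0 : ℝ) < N := by exact_mod_cast hN0
  have hmr0 : (0 : ℝ) < m := by exact_mod_cast hm
  set H := hypothesisSpace d m C₅ with hH
  set w := outerBound d m C₅ with hw
  have hw0 : 0 < w := outerBound_pos d hm hC₅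
  set M := m * w with hM
  have hM0 : 0 < M := mul_pos hmr0 hw0
  set Q := ⌈M * ((d : ℝ) + 2) * N⌉₊ with hQ
  have hQ0 : 0 < Q := Nat.ceil_pos.2 (by positivity)
  have hne : ((fun f => genError sqHinge ρ f - genError sqHinge ρ g) '' H).Nonempty :=
    ⟨_, _, zero_mem_hypothesisSpace d hm hC₅, rfl⟩
  -- A near-minimizer with slack `1/N` avoids asking that the infimum be attained.
  obtain ⟨_, ⟨f₀, hf₀, rfl⟩, hf₀lt⟩ := Real.lt_sInf_add_pos hne (one_div_pos.2 hNr)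
  have hf₀Δ : genError sqHinge ρ f₀ - genError sqHinge ρ (regressionFun ρ)
      ≤ Cp * (m : ℝ) ^ (-((4 * d + 8) / (5 * d + κ))) + 1 / N := by
    -- Replacing the minimizer by `f_ρ` as reference can only decrease the excess.
    have h1 := hg.genError_le (measurable_regressionFun ρ)
      (fun x => abs_le.2 (regressionFun_mem ρ x))
    have h2 : genError sqHinge ρ f₀ - genError sqHinge ρ g
      < approxError sqHinge ρ H g + 1 / N := hf₀lt
    linarith
  obtain ⟨A, hA, hAp, hAz⟩ := oracle_inequality ρ (H := H)
    (G := fun i : NetIndex d m Q => netFun w i) (fun i => measurable_shallowNet _ _ _)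
    (fun f hf => measurable_of_mem_hypothesisSpace hf)
    (fun f hf => exists_netFun_close hm hQ0 hC₅ hf) hf₀
    (abs_le_of_mem_hypothesisSpace hf₀) hN0 hδ
  refine ⟨A, hA, hAp, fun z hz f hf => (hAz z hz f hf).trans ?_⟩
  have hcard : Real.log (2 * Fintype.card (NetIndex d m Q) / δ)
      = m * (d + 2) * Real.log (2 * Q + 1) + Real.log (2 / δ) := by
    rw [card_netIndex, mul_div_right_comm, mul_comm, Nat.cast_pow,
      Real.log_mul (by positivity) (by positivity), Real.log_pow]
    push_cast
    ring
  rw [hcard]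
  have hpi := Real.pi_pos
  have hl : Real.log 2 ≤ Real.log (2 / δ) :=
    Real.log_le_log two_pos (by rw [le_div_iff₀ hδ]; linarith)
  obtain ⟨hM1, hM2⟩ := mul_outerBound_le hd hm hC₅
  exact error_terms_le (by positivity) (by positivity) hN0 hm hmN hM0 hM1 hM2 hl hCp hmN' hmr hf₀Δ

end Assembly

end ShallowClassification

/-! ### The learning rate for classification. -/

theorem theorem3 (d : ℕ) (hd : 0 < d) (C₅ θ cθ : ℝ) (hC₅ : 0 < C₅) (hθ : 0 < θ) (hcθ : 0 < cθ) :
    ∃ K : ℝ, 0 < K ∧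
      ∀ (p : ENNReal), 1 ≤ p →
      ∀ (ρ : Measure (Cube d × Label)) [IsProbabilityMeasure ρ] (fφ : Cube d → ℝ)
        (C₁ τ Cφ : ℝ) (m N : ℕ) (δ : ℝ),
        IsGenErrorMinimizer sqHinge ρ fφ →
        0 < C₁ → 0 < τ → τ ≤ 1 → VarianceCondition sqHinge ρ fφ C₁ τ →
        TsybakovNoise ρ θ cθ →
        0 < m →
        approxError sqHinge ρ (hypothesisSpace d m C₅) fφ
          ≤ Cφ * (m : ℝ) ^ (-((4 * d + 8) / (5 * d + pTerm d p))) →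
        (N = ⌊(m : ℝ) ^ ((9 * d + 8 + pTerm d p) / (5 * d + pTerm d p))⌋₊ ∨
          N = ⌈(m : ℝ) ^ ((9 * d + 8 + pTerm d p) / (5 * d + pTerm d p))⌉₊) →
        0 < δ →
        ∃ A : Set (Fin N → Cube d × Label), MeasurableSet A ∧
          1 - δ ≤ (Measure.pi (fun _ : Fin N => ρ)).real A ∧
          ∀ z ∈ A, ∀ fz : Cube d → ℝ,
            IsEmpMinimizer sqHinge z (hypothesisSpace d m C₅) fz →
            misclassError ρ (sgnClassifier fz) - misclassError ρ (bayesRule ρ)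
              ≤ K * max 1 Cφ ^ max 0 (θ / (2 + θ) - 1 / 2)
                * constC₈ Cφ C₁ (lossBound sqHinge (hypothesisSpace d m C₅)) N δ
                * (N : ℝ) ^ (-(θ / (2 + θ) * ((4 * d + 8) / (9 * d + 8 + pTerm d p)))) := by
  have hdr : (0 : ℝ) < d := by exact_mod_cast hd
  have hpi := Real.pi_pos
  set a := excessConst (4 * Real.pi ^ 2 * C₅) (d + 2) with ha
  have ha8 : 8 ≤ a := eight_le_excessConst (by positivity) (by positivity)
  -- The added 1 ensures `C ≥ 1`, as the trivial bound on the risk requires.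
  set C := 1 + (cθ + 1 / cθ) with hC
  have hcc : 0 < cθ + 1 / cθ := by positivity
  -- As `κ ≤ d²`, this bounds the rate from below for all `p`, which frees `K` from `p`.
  set r₀ : ℝ := (4 * d + 8) / (9 * d + 8 + d ^ 2) with hr₀
  have hr₀pos : 0 < r₀ := by positivity
  refine ⟨C * (16 * a + 16 * a * ((2 + θ) / r₀)), by positivity, ?_⟩
  intro p hp ρ _ fφ C₁ τ Cφ m N δ hmin hC₁ _ _ _ hT hm happ hN hδ
  obtain ⟨hκ0, hκd⟩ := pTerm_mem d hp
  rcases le_or_gt 1 δ with hδ1 | hδ1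
  · exact ⟨∅, MeasurableSet.empty, by simpa using hδ1, fun z hz => absurd hz (Set.notMem_empty z)⟩
  have hmr : (0 : ℝ) < m := by exact_mod_cast hm
  -- The approximation error is nonnegative, hence so is the constant bounding it.
  have hCφ : 0 ≤ Cφ := nonneg_of_mul_nonneg_left ((approxError_nonneg ρ hmin).trans happ)
    (Real.rpow_pos_of_pos hmr _)
  obtain ⟨A, hA, hAp, hAz⟩ := excess_rate hd hC₅ hκ0 ρ hmin hm happ hN hCφ hδ hδ1
  refine ⟨A, hA, hAp, fun z hz fz hfz => ?_⟩
  obtain ⟨hN0, -⟩ := sampleSize_estimates hdr hκ0 hm hN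
  have hNr : (1 : ℝ) ≤ N := by exact_mod_cast hN0
  have hNpos : (0 : ℝ) < N := by linarith
  have hlogN := Real.log_nonneg hNr
  have hl : Real.log 2 ≤ Real.log (2 / δ) :=
    Real.log_le_log two_pos (by rw [le_div_iff₀ hδ]; linarith)
  have hlog2 := Real.log_pos one_lt_two
  have hlpos : 0 < Real.log (2 / δ) := by linarith
  have hL : Real.log (2 * N / δ) = Real.log N + Real.log (2 / δ) := by
    rw [← Real.log_mul (by positivity) (by positivity)]
    congr 1; ring
  have hr : r₀ ≤ (4 * d + 8) / (9 * d + 8 + pTerm d p) := by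
    rw [hr₀]; gcongr
  refine rate_of_excess_bound (C := C) (A := a) hθ (by linarith) (by linarith) hr₀pos hr hCφ hN0 hl ?_ ?_ ?_
  · have hmax : max (Real.log N) (Real.log (2 * N / δ)) = Real.log N + Real.log (2 / δ) := by
      rw [hL]; exact max_eq_right (by linarith)
    have hL0 : 0 ≤ Real.log N + Real.log (2 / δ) := by linarith
    rw [hmax, ← mul_assoc]
    have h0 := lossBound_nonneg sqHinge (hypothesisSpace d m C₅)
    have h4 := le_max_left 4 C₁
    refine mul_le_mul_of_nonneg_right (mul_le_mul_of_nonneg_right (max_le ?_ ?_) hL0)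
      hlpos.le <;> linarith
  · have h1 := misclassError_le_one ρ (sgnClassifier fz)
    have h2 : 0 ≤ misclassError ρ (bayesRule ρ) := measureReal_nonneg
    linarith
  · have hE : 0 < a * (Cφ + (Real.log N + Real.log (2 / δ)))
        * (N : ℝ) ^ (-((4 * d + 8) / (9 * d + 8 + pTerm d p))) := by
      have := Real.rpow_pos_of_pos hNpos (-((4 * d + 8) / (9 * d + 8 + pTerm d p)))
      have : 0 < Cφ + (Real.log N + Real.log (2 / δ)) := by linarith
      positivity
    refine (misclassError_sub_le ρ hθ hcθ hT (measurable_of_mem_hypothesisSpace hfz.1) hE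
      (hAz z hz fz hfz)).trans (mul_le_mul_of_nonneg_right (by linarith) (by positivity))
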